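/- Let $A$ be Lebesgue measure on $\mathbb C$, and let $\alpha>0$. A weight is a non-negative, locally integrable function $w$ on $\mathbb C$ that is not almost everywhere zero; write $w(E)=\int_E w\,dA$. For $1<p<\infty$, $w\in A_p^{\mathrm{res}}$ means that for some $r>0$ $$\sup_{Q:\,\ell(Q)=r}\Big(\frac1{A(Q)}\int_Q w\,dA\Big)\Big(\frac1{A(Q)}\int_Q w^{-p'/p}\,dA\Big)^{p/p'}<\infty ,$$ and $w\in A_1^{\mathrm{res}}$ means that for some $r>0$ $$\sup_{Q:\,\ell(Q)=r}\Big(\frac1{A(Q)}\int_Q w\,dA\Big)\,\|w^{-1}\|_{L^\infty(Q)}<\infty ;$$ here $Q$ runs over the squares with sides parallel to the axes and side length $\ell(Q)=r$, and $1/p+1/p'=1$. Put $A_\infty^{\mathrm{res}}=\bigcup_{1\le p<\infty}A_p^{\mathrm{res}}$, and let $w\in A_\infty^{\mathrm{res}}$. Let $F^2_{\alpha,w}$ be the space of entire functions $f$ with $\|f\|^2=\int_{\mathbb C}|f(z)|^2e^{-\alpha|z|^2}w(z)\,dA(z)<\infty$, with the inner product $\langle f,g\rangle=\int_{\mathbb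 C} f\,\overline{g}\,e^{-\alpha|\cdot|^2}w\,dA$. Then for every $z\in\mathbb C$ it has a reproducing kernel $B^w_z\in F^2_{\alpha,w}$, i.e. $f(z)=\langle f,B^w_z\rangle$ for all $f\in F^2_{\alpha,w}$. Put $b^w_z=B^w_z/\|B^w_z\|$. For a positive Borel measure $\mu$ on $\mathbb C$ (possibly infinite, also on bounded sets), $r>0$ and $z\in\mathbb C$, let $$T_\mu f(z)=\int_{\mathbb C} f(\xi)\overline{B^w_z(\xi)}e^{-\alpha|\xi|^2}d\mu(\xi),\qquad \widetilde\mu(z)=\int_{\mathbb C}|b^w_z(\xi)|^2e^{-\alpha|\xi|^2}d\mu(\xi),\qquad \widehat\mu_{w,r}(z)=\frac{\mu(D(z,r))}{w(D(z,r))},$$ where $D(z,r)$ is the open disk with centre $z$ and radius $r$. "$T_\mu$ is compact on $F^2_{\alpha,w}$" means that for all $f\in F^2_{\alpha,w}$ and $z\in\mathbb C$ the integral defining $T_\mu f(z)$ converges absolutely, and that $f\mapsto T_\mu f$ is a compact (in particular bounded) linear operator from $F^2_{\alpha,w}$ to itself. There exists $\delta\in(0,1)$, depending only on $\alpha$ and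 $w$, such that for every positive Borel measure $\mu$ on $\mathbb C$ the following conditions are equivalent: (a) $T_\mu$ is compact on $F^2_{\alpha,w}$; (b) $\widetilde\mu(z)\to0$ as $|z|\to\infty$; (c) for some $r\in(0,\delta)$, $\widehat\mu_{w,r}$ is finite at every point of $\mathbb C$ and $\widehat\mu_{w,r}(z)\to0$ as $|z|\to\infty$; (d) for every $r\in(0,\delta)$, $\widehat\mu_{w,r}$ is finite at every point of $\mathbb C$ and $\widehat\mu_{w,r}(z)\to0$ as $|z|\to\infty$. -/

import Mathlib

open MeasureTheory Filter Topology
open scoped ENNReal ComplexConjugate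

noncomputable section

namespace WFock

/-- A weight on the complex plane: a non-negative, locally integrable function. The function that
vanishes almost everywhere is excluded. -/
structure Weight where
  toFun : ℂ → ℝ
  nonneg : ∀ z, 0 ≤ toFun z
  locallyIntegrable : LocallyIntegrable toFun volume
  not_ae_zero : ¬ toFun =ᵐ[volume] 0

instance : CoeFun Weight (fun _ => ℂ → ℝ) := ⟨Weight.toFun⟩

/-- The square with centre `c`, side length `r` and sides parallel to the coordinate axes. -/
def square (c : ℂ) (r : ℝ) : Set ℂ :=
  {z | |z.re - c.re| ≤ r / 2 ∧ |z.im - c.im| ≤ r / 2}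

/-- The mean value `(1 / A(Q)) ∫_Q f dA` over the square `Q = square c r`. -/
def squareMean (f : ℂ → ℝ≥0∞) (c : ℂ) (r : ℝ) : ℝ≥0∞ :=
  (∫⁻ z in square c r, f z) / volume (square c r)

namespace Weight

/-- `w(E) = ∫_E w dA`. -/
def mass (w : Weight) (E : Set ℂ) : ℝ≥0∞ :=
  ∫⁻ z in E, ENNReal.ofReal (w z)

/-- The restricted class `A_p`, for `1 < p < ∞` (`p' = p.conjExponent`). The integrand
`w ^ (-p'/p)` takes the value `∞` where `w = 0`. -/
def MemARes (w : Weight) (p : ℝ) : Prop :=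
  ∃ r : ℝ, 0 < r ∧
    (⨆ c : ℂ, squareMean (fun z => ENNReal.ofReal (w z)) c r *
      squareMean (fun z => ENNReal.ofReal (w z) ^ (-(p.conjExponent / p))) c r ^
        (p / p.conjExponent)) < ⊤

/-- The restricted class `A_1`. -/
def MemAResOne (w : Weight) : Prop :=
  ∃ r : ℝ, 0 < r ∧
    (⨆ c : ℂ, squareMean (fun z => ENNReal.ofReal (w z)) c r *
      essSup (fun z => (ENNReal.ofReal (w z))⁻¹) (volume.restrict (square c r))) < ⊤

/-- The restricted class `A_∞`, the union of the restricted classes `A_p`, `1 ≤ p < ∞`. -/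
def MemAResInfty (w : Weight) : Prop :=
  w.MemAResOne ∨ ∃ p : ℝ, 1 < p ∧ w.MemARes p

/-- The measure `e^{-α|z|²} w(z) dA(z)`. -/
def gaussMeasure (w : Weight) (α : ℝ) : Measure ℂ :=
  volume.withDensity (fun z => ENNReal.ofReal (Real.exp (-α * ‖z‖ ^ 2) * w z))

end Weight

/-- The entire functions `f` with `∫ |f(z)|² e^{-α|z|²} w(z) dA(z) < ∞`. -/
def fockSubmodule (α : ℝ) (w : Weight) : Submodule ℂ (ℂ → ℂ) where
  carrier := {f | Differentiable ℂ f ∧ MemLp f 2 (w.gaussMeasure α)}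
  add_mem' hf hg := ⟨hf.1.add hg.1, hf.2.add hg.2⟩
  zero_mem' := ⟨differentiable_const 0, MemLp.zero⟩
  smul_mem' c _ hf := ⟨hf.1.const_smul c, hf.2.const_smul c⟩

/-- The weighted Fock space `F²_{α,w}`. It is a type of its own so that it carries the topology of
its norm and not that of pointwise convergence. -/
def FockSpace (α : ℝ) (w : Weight) : Type := fockSubmodule α w

namespace FockSpace

variable {α : ℝ} {w : Weight}

instance : AddCommGroup (FockSpace α w) := inferInstanceAs (AddCommGroup (fockSubmodule α w))

instance : Module ℂ (FockSpace α w) := inferInstanceAs (Module ℂ (fockSubmodule α w))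

instance : CoeFun (FockSpace α w) (fun _ => ℂ → ℂ) := ⟨fun f => f.1⟩

/-- The inclusion of `F²_{α,w}` into `L²(e^{-α|z|²} w dA)`. -/
def toL2 : FockSpace α w →ₗ[ℂ] Lp ℂ 2 (w.gaussMeasure α) where
  toFun f := f.2.2.toLp f.1
  map_add' _ _ := rfl
  map_smul' _ _ := rfl

/-- An entire function that vanishes a.e. for `e^{-α|z|²} w dA` is zero. -/
theorem toL2_injective : Function.Injective (toL2 : FockSpace α w →ₗ[ℂ] _) := by
  rw [injective_iff_map_eq_zero]
  intro f hf
  have h0 : f.1 =ᵐ[w.gaussMeasure α] 0 := f.2.2.coeFn_toLp.symm.trans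
    ((Lp.eq_zero_iff_ae_eq_zero (f := f.2.2.toLp f.1)).1 hf)
  by_contra hne
  have han : AnalyticOnNhd ℂ f.1 Set.univ := fun z _ => f.2.1.analyticAt z
  have hex : ∃ x, f.1 x ≠ 0 := by
    by_contra hall
    push Not at hall
    exact hne (Subtype.ext (funext hall))
  obtain ⟨x, hx⟩ := hex
  have hcod : f.1 ⁻¹' {0}ᶜ ∈ codiscrete ℂ :=
    han.preimage_zero_mem_codiscrete (x := x) hx
  have hae : ∀ᵐ z ∂(volume : Measure ℂ), f.1 z ≠ 0 := by
    have := ae_restrict_le_codiscreteWithin (U := (Set.univ : Set ℂ)) (μ := volume)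
      MeasurableSet.univ hcod
    rw [Measure.restrict_univ] at this
    exact this
  have hmeas : AEMeasurable (fun z => ENNReal.ofReal (Real.exp (-α * ‖z‖ ^ 2) * w z))
      (volume : Measure ℂ) := by
    refine AEMeasurable.ennreal_ofReal (AEMeasurable.mul ?_ ?_)
    · exact (by fun_prop : Continuous fun z : ℂ => Real.exp (-α * ‖z‖ ^ 2)).aemeasurable
    · exact w.locallyIntegrable.aestronglyMeasurable.aemeasurable
  have h1 := (ae_withDensity_iff' hmeas).1 h0
  apply w.not_ae_zero
  filter_upwards [hae, h1] with z hz hz1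
  by_contra hw
  have hpos : 0 < w z := lt_of_le_of_ne (w.nonneg z) (Ne.symm hw)
  exact hz (hz1 (ENNReal.ofReal_pos.2 (by positivity)).ne')

/-- The norm of `F²_{α,w}` is that of `L²(e^{-α|z|²} w dA)`. -/
instance : NormedAddCommGroup (FockSpace α w) :=
  NormedAddCommGroup.induced (FockSpace α w) (Lp ℂ 2 (w.gaussMeasure α)) toL2 toL2_injective

/-- The inner product of `F²_{α,w}` is that of `L²(e^{-α|z|²} w dA)`; as everywhere in Mathlib,
`inner ℂ g f` is linear in `f`. -/
instance : InnerProductSpace ℂ (FockSpace α w) where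
  toNormedSpace := NormedSpace.induced ℂ (FockSpace α w) (Lp ℂ 2 (w.gaussMeasure α)) toL2
  inner f g := inner ℂ (toL2 f) (toL2 g)
  norm_sq_eq_re_inner f := norm_sq_eq_re_inner (𝕜 := ℂ) (toL2 f)
  conj_inner_symm f g := inner_conj_symm (toL2 f) (toL2 g)
  add_left f g h := by rw [map_add, inner_add_left]
  smul_left f g c := by rw [map_smul, inner_smul_left]

/-- The inner product written out as an integral. -/
theorem inner_eq_integral (f g : FockSpace α w) :
    inner ℂ g f = ∫ ξ, f ξ * conj (g ξ) * (Real.exp (-α * ‖ξ‖ ^ 2) * w ξ : ℝ) := by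
  have hmeas : AEMeasurable (fun z => ENNReal.ofReal (Real.exp (-α * ‖z‖ ^ 2) * w z))
      (volume : Measure ℂ) := by
    refine AEMeasurable.ennreal_ofReal (AEMeasurable.mul ?_ ?_)
    · exact (by fun_prop : Continuous fun z : ℂ => Real.exp (-α * ‖z‖ ^ 2)).aemeasurable
    · exact w.locallyIntegrable.aestronglyMeasurable.aemeasurable
  have h1 : inner ℂ g f = ∫ ξ, f ξ * conj (g ξ) ∂(w.gaussMeasure α) := by
    change inner ℂ (toL2 g) (toL2 f) = _
    rw [L2.inner_def]
    refine integral_congr_ae ?_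
    filter_upwards [f.2.2.coeFn_toLp, g.2.2.coeFn_toLp] with z hf hg
    change inner ℂ ((g.2.2.toLp g.1) z) ((f.2.2.toLp f.1) z) = _
    rw [hf, hg]
    rfl
  rw [h1, Weight.gaussMeasure, integral_withDensity_eq_integral_toReal_smul₀ hmeas
    (Eventually.of_forall fun _ => ENNReal.ofReal_lt_top)]
  refine integral_congr_ae (Eventually.of_forall fun z => ?_)
  have hz : 0 ≤ Real.exp (-α * ‖z‖ ^ 2) * w z := mul_nonneg (Real.exp_pos _).le (w.nonneg z)
  simp only [ENNReal.toReal_ofReal hz, Complex.real_smul]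
  ring

end FockSpace

/-- `B` is a reproducing kernel of `F²_{α,w}` at the point `z`. -/
def IsReproducingKernelAt {α : ℝ} {w : Weight} (z : ℂ) (B : FockSpace α w) : Prop :=
  ∀ f : FockSpace α w, f z = inner ℂ B f

/-- The reproducing kernel `B^w_z` of `F²_{α,w}` at `z` (there is at most one; an arbitrary element
if there is none). -/
def kernel (α : ℝ) (w : Weight) (z : ℂ) : FockSpace α w :=
  Classical.epsilon (IsReproducingKernelAt z)

/-- The normalized reproducing kernel `b^w_z = B^w_z / ‖B^w_z‖`. -/
def normalizedKernel (α : ℝ) (w : Weight) (z : ℂ) : FockSpace α w :=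
  ((‖kernel α w z‖⁻¹ : ℝ) : ℂ) • kernel α w z

/-- The integrand `f(ξ) conj(B^w_z(ξ)) e^{-α|ξ|²}` of `T_μ f(z)`. -/
def toeplitzIntegrand {α : ℝ} {w : Weight} (f : FockSpace α w) (z ξ : ℂ) : ℂ :=
  f ξ * conj (kernel α w z ξ) * (Real.exp (-α * ‖ξ‖ ^ 2) : ℂ)

/-- The bounded operator `T` on `F²_{α,w}` is the Toeplitz operator `T_μ`: for all `f` and `z`, the
integral that defines `T_μ f(z)` converges absolutely, and `T f(z)` is its value. -/
def IsToeplitz {α : ℝ} {w : Weight} (μ : Measure ℂ) (T : FockSpace α w →L[ℂ] FockSpace α w) :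
    Prop :=
  ∀ (f : FockSpace α w) (z : ℂ),
    Integrable (toeplitzIntegrand f z) μ ∧ (T f) z = ∫ ξ, toeplitzIntegrand f z ξ ∂μ

/-- `T_μ` is (well defined, bounded and) compact on `F²_{α,w}`. -/
def ToeplitzCompact (α : ℝ) (w : Weight) (μ : Measure ℂ) : Prop :=
  ∃ T : FockSpace α w →L[ℂ] FockSpace α w, IsToeplitz μ T ∧ IsCompactOperator T

/-- The Berezin transform of `μ`, with values in `[0, ∞]`. -/
def berezin (α : ℝ) (w : Weight) (μ : Measure ℂ) (z : ℂ) : ℝ≥0∞ :=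
  ∫⁻ ξ, ENNReal.ofReal (‖normalizedKernel α w z ξ‖ ^ 2 * Real.exp (-α * ‖ξ‖ ^ 2)) ∂μ

/-- The average function `μ(D(z,r)) / w(D(z,r))`, with values in `[0, ∞]`. -/
def average (w : Weight) (μ : Measure ℂ) (r : ℝ) (z : ℂ) : ℝ≥0∞ :=
  μ (Metric.ball z r) / w.mass (Metric.ball z r)

/-- `μ̂_{w,r}` is a finite function on `ℂ` that tends to `0` as `|z| → ∞`. (Finiteness is automatic
if `μ` is finite on bounded sets.) -/
def AverageVanishes (w : Weight) (μ : Measure ℂ) (r : ℝ) : Prop :=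
  (∀ z, average w μ r z < ⊤) ∧ Tendsto (average w μ r) (Bornology.cobounded ℂ) (𝓝 0)

end WFock

end

open MeasureTheory Filter Topology
open scoped ENNReal ComplexConjugate

noncomputable section

namespace WFock

/-! Write V(z) for the `w`-mass of the square of side r about z. The weight condition enters only
through one Hölder inequality on squares of side r (`Weight.SquareBound`). Tested on indicators of
discs, it makes V(z) comparable to the mass of small discs about z and lets V grow at most
exponentially, so Gaussians beat it. Tested on |f|², together with subharmonicity of |f|^(2/p), it
bounds V(z)|f(z)|²e^{-α|z|²} by the energy of f near z (`Weight.Regular.exists_pointwise_le`). Hence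
‖B_z‖² is comparable to e^{α|z|²}/V(z), and Schwarz's lemma extends the lower bound for |b_z| from z
to a disc of fixed radius δ (`exists_le_normalizedKernel`).

Compactness gives (b): the b_z tend weakly to 0, and the Berezin transform is ⟨T b_z, b_z⟩. (b)
gives (d): on D(z,δ) the integrand of the Berezin transform is at least a constant over V(z), so the
averages are dominated by it; local finiteness of μ comes from kernels B_z with z far away. (c)
gives compactness: a Carleson inequality makes the part of ∫|f|²e^{-α|·|²}dμ far from 0 small
relative to ‖f‖², so the inclusion J into L²(e^{-α|·|²}dμ) is a norm limit of finite rank operators,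
and T_μ = J*J. -/

/-! ### Squares, and the restricted A_p condition as a Hölder inequality -/

theorem isClosed_square (c : ℂ) (r : ℝ) : IsClosed (square c r) := by
  have h1 : Continuous fun z : ℂ => |z.re - c.re| := by fun_prop
  have h2 : Continuous fun z : ℂ => |z.im - c.im| := by fun_prop
  exact (isClosed_le h1 continuous_const).inter (isClosed_le h2 continuous_const)

theorem measurableSet_square (c : ℂ) (r : ℝ) : MeasurableSet (square c r) :=
  (isClosed_square c r).measurableSet

theorem ball_subset_square (c : ℂ) (r : ℝ) : Metric.ball c (r / 2) ⊆ square c r := by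
  intro z hz
  rw [Metric.mem_ball, Complex.dist_eq] at hz
  exact ⟨by simpa using (Complex.abs_re_le_norm (z - c)).trans hz.le,
    by simpa using (Complex.abs_im_le_norm (z - c)).trans hz.le⟩

theorem square_subset_closedBall (c : ℂ) (r : ℝ) : square c r ⊆ Metric.closedBall c r := by
  rintro z ⟨h1, h2⟩
  rw [Metric.mem_closedBall, Complex.dist_eq]
  have := Complex.norm_le_abs_re_add_abs_im (z - c)
  simp only [Complex.sub_re, Complex.sub_im] at this
  linarith

theorem volume_square_ne_zero (c : ℂ) {r : ℝ} (hr : 0 < r) : volume (square c r) ≠ 0 :=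
  ((Metric.measure_ball_pos volume c (half_pos hr)).trans_le
    (measure_mono (ball_subset_square c r))).ne'

theorem volume_square_le (c : ℂ) (r : ℝ) :
    volume (square c r) ≤ volume (Metric.closedBall (0 : ℂ) r) := by
  rw [← Measure.addHaar_closedBall_center volume c r]
  exact measure_mono (square_subset_closedBall c r)

theorem volume_square_ne_top (c : ℂ) (r : ℝ) : volume (square c r) ≠ ⊤ :=
  ((volume_square_le c r).trans_lt measure_closedBall_lt_top).ne

namespace Weight

variable (w : Weight)

theorem aemeasurable : AEMeasurable w volume :=
  w.locallyIntegrable.aestronglyMeasurable.aemeasurable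

/-- The measure `w dA`. -/
def measure : Measure ℂ := volume.withDensity fun z => ENNReal.ofReal (w z)

theorem mass_eq_measure {E : Set ℂ} (hE : MeasurableSet E) : w.mass E = w.measure E :=
  (withDensity_apply _ hE).symm

theorem measure_ne_zero : w.measure ≠ 0 := by
  intro h
  rw [measure, withDensity_eq_zero_iff w.aemeasurable.ennreal_ofReal] at h
  apply w.not_ae_zero
  filter_upwards [h] with z hz
  exact le_antisymm (ENNReal.ofReal_eq_zero.1 hz) (w.nonneg z)

instance : IsLocallyFiniteMeasure w.measure := by
  constructor
  intro z
  obtain ⟨U, hU, hi⟩ := w.locallyIntegrable z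
  refine ⟨interior U, interior_mem_nhds.2 hU, ?_⟩
  rw [measure, withDensity_apply _ isOpen_interior.measurableSet]
  have := (hi.mono_set interior_subset).lintegral_lt_top
  exact this

/-- The form in which the condition `A_p` is used: Hölder's inequality on squares of a fixed
side length. -/
def SquareBound (r p : ℝ) (K : ℝ≥0∞) : Prop :=
  ∀ (c : ℂ) (h : ℂ → ℝ≥0∞), Measurable h →
    w.measure (square c r) * (∫⁻ z in square c r, h z ^ (1 / p)) ^ p ≤
      K * ∫⁻ z in square c r, h z ∂w.measure

variable {w}

/-- Hölder's inequality for h^(1/p) = (hw)^(1/p) · w^(-1/p), the last factor being a power of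
w^(-1/(p-1)). The side length is fixed, so the areas that turn means into integrals are absorbed in
the constant. -/
theorem squareBound_of_mean_le {r p : ℝ} (hr : 0 < r) (hp : 1 < p) {K : ℝ≥0∞}
    (hK : ∀ c, squareMean (fun z => ENNReal.ofReal (w z)) c r *
      squareMean (fun z => ENNReal.ofReal (w z) ^ (-(1 / (p - 1)))) c r ^ (p - 1) ≤ K)
    (hKt : K ≠ ⊤) :
    ∃ K' : ℝ≥0∞, K' ≠ ⊤ ∧ w.SquareBound r p K' := by
  set A : ℝ≥0∞ := volume (Metric.closedBall (0 : ℂ) r)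
  have hA : A ≠ ⊤ := measure_closedBall_lt_top.ne
  have hp1 : 0 < p - 1 := by linarith
  refine ⟨K * (A * A ^ (p - 1)), ENNReal.mul_ne_top hKt (ENNReal.mul_ne_top hA
    (ENNReal.rpow_ne_top_of_nonneg hp1.le hA)), fun c h hh => ?_⟩
  have hm := measurableSet_square c r
  have haw : AEMeasurable (fun z => ENNReal.ofReal (w z)) (volume.restrict (square c r)) :=
    w.aemeasurable.ennreal_ofReal.restrict
  set M : ℝ≥0∞ := ∫⁻ z in square c r, ENNReal.ofReal (w z) with hM
  set S : ℝ≥0∞ := ∫⁻ z in square c r, ENNReal.ofReal (w z) ^ (-(1 / (p - 1))) with hS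
  have hMm : w.measure (square c r) = M := withDensity_apply _ hm
  rw [hMm]
  rcases eq_or_ne M 0 with h0 | h0
  · rw [h0]; simp
  have hv0 := volume_square_ne_zero c hr
  have hvt := volume_square_ne_top c r
  have key : M * S ^ (p - 1) ≤ K * (A * A ^ (p - 1)) := by
    have h1 := hK c
    simp only [squareMean] at h1
    rw [← hM, ← hS] at h1
    rw [ENNReal.div_rpow_of_nonneg _ _ hp1.le] at h1
    have e1 : M * S ^ (p - 1) = (M / volume (square c r) *
        (S ^ (p - 1) / volume (square c r) ^ (p - 1))) *
        (volume (square c r) * volume (square c r) ^ (p - 1)) := by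
      have a1 : M = M / volume (square c r) * volume (square c r) :=
        (ENNReal.div_mul_cancel hv0 hvt).symm
      have a2 : S ^ (p - 1) = S ^ (p - 1) / volume (square c r) ^ (p - 1) *
          volume (square c r) ^ (p - 1) :=
        (ENNReal.div_mul_cancel (by simp [ENNReal.rpow_eq_zero_iff, hv0, hvt])
          (ENNReal.rpow_ne_top_of_nonneg hp1.le hvt)).symm
      conv_lhs => rw [a1, a2]
      ring
    rw [e1]
    have := volume_square_le c r
    gcongr
  -- Since M ≠ 0, the bound on M * S ^ (p - 1) forces S to be finite; then w > 0 almost everywhere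
  -- on the square, which the factorization of h^(1/p) needs.
  have hSt : S ≠ ⊤ := by
    intro ht
    rw [ht, ENNReal.top_rpow_of_pos hp1, ENNReal.mul_top h0, top_le_iff] at key
    exact ENNReal.mul_ne_top hKt (ENNReal.mul_ne_top hA
      (ENNReal.rpow_ne_top_of_nonneg hp1.le hA)) key
  have hpos : ∀ᵐ z ∂(volume.restrict (square c r)), ENNReal.ofReal (w z) ≠ 0 := by
    filter_upwards [ae_lt_top' (haw.pow_const _) hSt] with z hz h0
    rw [h0, ENNReal.zero_rpow_of_neg (by simpa using hp1)] at hz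
    exact lt_irrefl _ hz
  have hint : ∫⁻ z in square c r, h z ∂w.measure =
      ∫⁻ z in square c r, h z * ENNReal.ofReal (w z) := by
    rw [measure, restrict_withDensity hm, lintegral_withDensity_eq_lintegral_mul₀ haw
      hh.aemeasurable]
    refine lintegral_congr fun z => ?_
    simp [mul_comm]
  have hold : ∫⁻ z in square c r, h z ^ (1 / p) ≤
      (∫⁻ z in square c r, h z * ENNReal.ofReal (w z)) ^ (1 / p) * S ^ ((p - 1) / p) := by
    refine le_trans (le_of_eq ?_) (ENNReal.lintegral_mul_norm_pow_le
      (hh.aemeasurable.mul haw) (haw.pow_const _) (by positivity) (by positivity)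
      (by field_simp; ring))
    refine lintegral_congr_ae ?_
    filter_upwards [hpos] with z hz
    simp only [Pi.mul_apply]
    rw [ENNReal.mul_rpow_of_nonneg _ _ (by positivity), ← ENNReal.rpow_mul, mul_assoc,
      ← ENNReal.rpow_add _ _ hz ENNReal.ofReal_ne_top]
    have : 1 / p + -(1 / (p - 1)) * ((p - 1) / p) = 0 := by field_simp; ring
    rw [this]
    simp
  rw [hint]
  calc M * (∫⁻ z in square c r, h z ^ (1 / p)) ^ p
      ≤ M * ((∫⁻ z in square c r, h z * ENNReal.ofReal (w z)) ^ (1 / p) *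
        S ^ ((p - 1) / p)) ^ p := by gcongr
    _ = M * S ^ (p - 1) * ∫⁻ z in square c r, h z * ENNReal.ofReal (w z) := by
        rw [ENNReal.mul_rpow_of_nonneg _ _ (by positivity), ← ENNReal.rpow_mul,
          ← ENNReal.rpow_mul]
        have e1 : 1 / p * p = 1 := by field_simp
        have e2 : (p - 1) / p * p = p - 1 := by field_simp
        rw [e1, e2, ENNReal.rpow_one]
        ring
    _ ≤ _ := by gcongr

/-- A mean of 1/w is at most its essential supremum, so the A_1 case reduces to p = 2 with the same
side length. For p > 1 the exponent p/p' is p - 1. -/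
theorem MemAResInfty.exists_squareBound (hw : w.MemAResInfty) :
    ∃ r p : ℝ, ∃ K : ℝ≥0∞, 0 < r ∧ 1 < p ∧ K ≠ ⊤ ∧ w.SquareBound r p K := by
  rcases hw with ⟨r, hr, h⟩ | ⟨p, hp, r, hr, h⟩
  · have key := squareBound_of_mean_le (w := w) hr one_lt_two (fun c => ?_) h.ne
    · obtain ⟨K, hK, hb⟩ := key
      exact ⟨r, 2, K, hr, one_lt_two, hK, hb⟩
    · refine le_trans ?_ (le_iSup _ c)
      gcongr
      have e1 : (2 : ℝ) - 1 = 1 := by norm_num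
      rw [e1, ENNReal.rpow_one]
      simp only [div_one]
      refine ENNReal.div_le_of_le_mul ?_
      refine (lintegral_mono_ae (g := fun _ => essSup (fun z => (ENNReal.ofReal (w z))⁻¹)
        (volume.restrict (square c r))) ?_).trans (by simp)
      filter_upwards [ENNReal.ae_le_essSup (μ := volume.restrict (square c r))
        (fun z => (ENNReal.ofReal (w z))⁻¹)] with z hz
      rwa [ENNReal.rpow_neg_one]
  · have e1 : p / p.conjExponent = p - 1 := by
      unfold Real.conjExponent
      have : p - 1 ≠ 0 := by linarith
      field_simp
    have e2 : p.conjExponent / p = 1 / (p - 1) := by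
      unfold Real.conjExponent
      have : p - 1 ≠ 0 := by linarith
      field_simp
    rw [e1, e2] at h
    obtain ⟨K, hK, hb⟩ := squareBound_of_mean_le (w := w) hr hp (fun c => le_iSup (fun c =>
      squareMean (fun z => ENNReal.ofReal (w z)) c r *
      squareMean (fun z => ENNReal.ofReal (w z) ^ (-(1 / (p - 1)))) c r ^ (p - 1)) c) h.ne
    exact ⟨r, p, K, hr, hp, hK, hb⟩

end Weight

/-! ### Local masses of the weight: comparison, growth, Gaussian integrals -/

theorem integrable_exp_neg_mul_sq_norm {a : ℝ} (ha : 0 < a) :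
    Integrable (fun u : ℂ => Real.exp (-a * ‖u‖ ^ 2)) := by
  have h := (GaussianFourier.integrable_cexp_neg_mul_sq_norm_add (V := ℂ) (b := a)
    (by simpa using ha) 0 0).norm
  refine h.congr (Eventually.of_forall fun u => ?_)
  simp only [Complex.norm_exp]
  congr 1
  rw [zero_mul, add_zero, ← Complex.ofReal_pow, ← Complex.ofReal_neg, ← Complex.ofReal_mul,
    Complex.ofReal_re]

theorem lintegral_exp_neg_sq_add_linear_ne_top {a b : ℝ} (ha : 0 < a) :
    ∫⁻ u : ℂ, ENNReal.ofReal (Real.exp (-a * ‖u‖ ^ 2 + b * (‖u‖ + 1))) ≠ ⊤ := by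
  have h := ((integrable_exp_neg_mul_sq_norm (half_pos ha)).const_mul
    (Real.exp (b ^ 2 / (2 * a) + b))).lintegral_lt_top
  refine (lt_of_le_of_lt (lintegral_mono fun u => ?_) h).ne
  refine ENNReal.ofReal_le_ofReal ?_
  rw [← Real.exp_add]
  refine Real.exp_le_exp.2 ?_
  have h1 : b * ‖u‖ ≤ a / 2 * ‖u‖ ^ 2 + b ^ 2 / (2 * a) := by
    have : a / 2 * ‖u‖ ^ 2 + b ^ 2 / (2 * a) - b * ‖u‖ = (a * ‖u‖ - b) ^ 2 / (2 * a) := by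
      field_simp; ring
    have h2 : 0 ≤ (a * ‖u‖ - b) ^ 2 / (2 * a) := by positivity
    linarith
  linarith

namespace Weight

/-- The hypothesis on `w` that is used throughout: Hölder's inequality on squares of side `r`. -/
structure Regular (w : Weight) (r p : ℝ) (K : ℝ≥0∞) : Prop where
  pos : 0 < r
  one_lt : 1 < p
  ne_top : K ≠ ⊤
  bound : w.SquareBound r p K

theorem MemAResInfty.exists_regular {w : Weight} (hw : w.MemAResInfty) :
    ∃ r p : ℝ, ∃ K : ℝ≥0∞, w.Regular r p K :=
  let ⟨r, p, K, h1, h2, h3, h4⟩ := hw.exists_squareBound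
  ⟨r, p, K, h1, h2, h3, h4⟩

/-- The mass of the square with centre `z` and side length `r`. -/
def sqMass (w : Weight) (r : ℝ) (z : ℂ) : ℝ := (w.measure (square z r)).toReal

theorem measure_square_ne_top (w : Weight) (r : ℝ) (z : ℂ) : w.measure (square z r) ≠ ⊤ :=
  ((measure_mono (square_subset_closedBall z r)).trans_lt measure_closedBall_lt_top).ne

theorem ofReal_sqMass (w : Weight) (r : ℝ) (z : ℂ) :
    ENNReal.ofReal (w.sqMass r z) = w.measure (square z r) :=
  ENNReal.ofReal_toReal (w.measure_square_ne_top r z)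

theorem measurable_sqMass (w : Weight) (r : ℝ) : Measurable (w.sqMass r) := by
  have h1 : Continuous fun q : ℂ × ℂ => |q.2.re - q.1.re| := by fun_prop
  have h2 : Continuous fun q : ℂ × ℂ => |q.2.im - q.1.im| := by fun_prop
  have hm := ((isClosed_le h1 (continuous_const (y := r / 2))).inter
    (isClosed_le h2 (continuous_const (y := r / 2)))).measurableSet
  have h := (measurable_measure_prodMk_left (ν := w.measure) hm).ennreal_toReal
  have e : w.sqMass r = fun z => (w.measure (Prod.mk z ⁻¹'
      ({q : ℂ × ℂ | |q.2.re - q.1.re| ≤ r / 2} ∩ {q | |q.2.im - q.1.im| ≤ r / 2}))).toReal := by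
    ext z
    rfl
  rw [e]
  exact h

theorem measure_ball_le_sqMass (w : Weight) {r s : ℝ} (hs : s ≤ r / 2) (z : ℂ) :
    w.measure (Metric.ball z s) ≤ ENNReal.ofReal (w.sqMass r z) := by
  rw [ofReal_sqMass]
  exact measure_mono ((Metric.ball_subset_ball hs).trans (ball_subset_square z r))

namespace Regular

variable {w : Weight} {r p : ℝ} {K : ℝ≥0∞}

/-- The Hölder inequality tested on the indicator of the disc, which equals its own power 1/p. -/
theorem measure_square_mul_le (H : w.Regular r p K) {c x : ℂ} {s : ℝ}
    (hx : Metric.ball x s ⊆ square c r) :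
    w.measure (square c r) * volume (Metric.ball (0 : ℂ) s) ^ p ≤
      K * w.measure (Metric.ball x s) := by
  have hp := H.one_lt
  have h := H.bound c ((Metric.ball x s).indicator 1)
    (measurable_one.indicator Metric.isOpen_ball.measurableSet)
  have e : ∀ z, (Metric.ball x s).indicator (1 : ℂ → ℝ≥0∞) z ^ (1 / p) =
      (Metric.ball x s).indicator 1 z := by
    intro z
    by_cases hz : z ∈ Metric.ball x s
    · simp [hz]
    · simp only [hz, not_false_eq_true, Set.indicator_of_notMem]
      exact ENNReal.zero_rpow_of_pos (by positivity)
  simp only [e] at h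
  rw [lintegral_indicator_one Metric.isOpen_ball.measurableSet,
    lintegral_indicator_one Metric.isOpen_ball.measurableSet,
    Measure.restrict_apply Metric.isOpen_ball.measurableSet,
    Measure.restrict_apply Metric.isOpen_ball.measurableSet,
    Set.inter_eq_left.2 hx, Measure.addHaar_ball_center] at h
  exact h

theorem exists_measure_square_le (H : w.Regular r p K) {s : ℝ} (hs : 0 < s) :
    ∃ C : ℝ, 0 < C ∧ ∀ c x : ℂ, Metric.ball x s ⊆ square c r →
      w.measure (square c r) ≤ ENNReal.ofReal C * w.measure (Metric.ball x s) := by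
  have hp := H.one_lt
  set v : ℝ≥0∞ := volume (Metric.ball (0 : ℂ) s) ^ p
  have hv0 : v ≠ 0 := by
    have := (Metric.measure_ball_pos volume (0 : ℂ) hs).ne'
    simp only [v, ne_eq, ENNReal.rpow_eq_zero_iff, this, measure_ball_lt_top.ne]
    simp
  have hvt : v ≠ ⊤ := ENNReal.rpow_ne_top_of_nonneg (by linarith) measure_ball_lt_top.ne
  have hKv : K / v ≠ ⊤ := ENNReal.div_ne_top H.ne_top hv0
  refine ⟨(K / v).toReal + 1, by positivity, fun c x hx => ?_⟩
  have h := H.measure_square_mul_le hx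
  have h2 : w.measure (square c r) ≤ K / v * w.measure (Metric.ball x s) := by
    rw [← ENNReal.mul_div_right_comm]
    exact (ENNReal.le_div_iff_mul_le (Or.inl hv0) (Or.inl hvt)).2 h
  refine h2.trans ?_
  gcongr
  rw [ENNReal.le_ofReal_iff_toReal_le hKv (by positivity)]
  linarith

theorem exists_sqMass_le_measure_ball (H : w.Regular r p K) {s : ℝ} (hs : 0 < s)
    (hsr : s ≤ r / 2) :
    ∃ C : ℝ, 0 < C ∧ ∀ z : ℂ,
      ENNReal.ofReal (w.sqMass r z) ≤ ENNReal.ofReal C * w.measure (Metric.ball z s) := by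
  obtain ⟨C, hC, h⟩ := H.exists_measure_square_le hs
  exact ⟨C, hC, fun z => (w.ofReal_sqMass r z).trans_le
    (h z z ((Metric.ball_subset_ball hsr).trans (ball_subset_square z r)))⟩

/-- The disc of radius r/4 about the midpoint of z and z' lies in both squares; its mass controls
the first and is at most that of the second. -/
theorem exists_sqMass_le_of_near (H : w.Regular r p K) :
    ∃ C : ℝ, 1 ≤ C ∧ ∀ z z' : ℂ, ‖z - z'‖ ≤ r / 2 → w.sqMass r z ≤ C * w.sqMass r z' := by
  have hr := H.pos
  obtain ⟨C, hC, h⟩ := H.exists_measure_square_le (s := r / 4) (by positivity)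
  refine ⟨max C 1, le_max_right _ _, fun z z' hz => ?_⟩
  have hsub : ∀ a b : ℂ, ‖a - b‖ ≤ r / 2 → Metric.ball ((a + b) / 2) (r / 4) ⊆ square a r := by
    intro a b hab
    refine (Metric.ball_subset_ball' ?_).trans (ball_subset_square a r)
    rw [Complex.dist_eq]
    have : (a + b) / 2 - a = (b - a) / 2 := by ring
    rw [this, norm_div, norm_sub_rev]
    norm_num
    linarith
  have h1 := h z ((z + z') / 2) (hsub z z' hz)
  have h2 : w.measure (Metric.ball ((z + z') / 2) (r / 4)) ≤ w.measure (square z' r) := by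
    refine measure_mono ?_
    rw [add_comm]
    exact hsub z' z (by rwa [norm_sub_rev])
  have h3 : w.measure (square z r) ≤ ENNReal.ofReal C * w.measure (square z' r) :=
    h1.trans (by gcongr)
  have h4 := ENNReal.toReal_mono (ENNReal.mul_ne_top ENNReal.ofReal_ne_top
    (w.measure_square_ne_top r z')) h3
  rw [ENNReal.toReal_mul, ENNReal.toReal_ofReal hC.le] at h4
  refine h4.trans ?_
  exact mul_le_mul_of_nonneg_right (le_max_left _ _) ENNReal.toReal_nonneg

theorem exists_sqMass_le_exp (H : w.Regular r p K) :
    ∃ b : ℝ, 0 ≤ b ∧ ∀ z z' : ℂ,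
      w.sqMass r z ≤ Real.exp (b * (‖z - z'‖ + 1)) * w.sqMass r z' := by
  have hr := H.pos
  obtain ⟨C, hC, h⟩ := H.exists_sqMass_le_of_near
  have hn : ∀ n : ℕ, ∀ z z' : ℂ, ‖z - z'‖ ≤ n * (r / 2) →
      w.sqMass r z ≤ C ^ n * w.sqMass r z' := by
    intro n
    induction n with
    | zero =>
      intro z z' hz
      have : z = z' := by
        rw [← sub_eq_zero, ← norm_le_zero_iff]; simpa using hz
      simp [this]
    | succ n ih =>
      intro z z' hz
      push_cast at hz
      -- The point of the segment at the fraction 1/(n+1) from z': one short step to z', and n short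
      -- steps from z.
      set y : ℂ := z' + (1 / (n + 1) : ℝ) • (z - z') with hy
      have e1 : z - y = (n / (n + 1) : ℝ) • (z - z') := by
        have : (n / (n + 1) : ℝ) = 1 - 1 / (n + 1) := by field_simp; ring
        rw [this, hy, sub_smul, one_smul]; ring
      have e2 : y - z' = (1 / (n + 1) : ℝ) • (z - z') := by rw [hy]; ring
      have h1 : ‖z - y‖ ≤ n * (r / 2) := by
        rw [e1, norm_smul, Real.norm_of_nonneg (by positivity), div_mul_eq_mul_div,
          div_le_iff₀ (by positivity)]
        nlinarith [mul_le_mul_of_nonneg_left hz (Nat.cast_nonneg (α := ℝ) n)]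
      have h2 : ‖y - z'‖ ≤ r / 2 := by
        rw [e2, norm_smul, Real.norm_of_nonneg (by positivity), div_mul_eq_mul_div,
          div_le_iff₀ (by positivity)]
        linarith
      calc w.sqMass r z ≤ C ^ n * w.sqMass r y := ih z y h1
        _ ≤ C ^ n * (C * w.sqMass r z') := by gcongr; exact h y z' h2
        _ = _ := by ring
  have hl : 0 ≤ Real.log C := Real.log_nonneg hC
  refine ⟨Real.log C * (2 / r + 1), by positivity, fun z z' => ?_⟩
  set n := ⌈2 / r * ‖z - z'‖⌉₊
  have h1 := hn n z z' (by
    have : 2 / r * ‖z - z'‖ ≤ n := Nat.le_ceil _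
    calc ‖z - z'‖ = 2 / r * ‖z - z'‖ * (r / 2) := by field_simp
      _ ≤ _ := by gcongr)
  refine h1.trans (mul_le_mul_of_nonneg_right ?_ ENNReal.toReal_nonneg)
  rw [← Real.exp_log (show 0 < C by linarith), ← Real.exp_nat_mul, Real.log_exp]
  refine Real.exp_le_exp.2 ?_
  have h2 : (n : ℝ) ≤ 2 / r * ‖z - z'‖ + 1 := (Nat.ceil_lt_add_one (by positivity)).le
  have h3 : (n : ℝ) ≤ (2 / r + 1) * (‖z - z'‖ + 1) := by
    have : 0 ≤ 2 / r := by positivity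
    nlinarith [norm_nonneg (z - z')]
  nlinarith [mul_le_mul_of_nonneg_left h3 hl]

/-- By the growth estimate, one square of mass zero makes all of them null, against the weight not
vanishing almost everywhere. -/
theorem sqMass_pos (H : w.Regular r p K) (z : ℂ) : 0 < w.sqMass r z := by
  have hr := H.pos
  obtain ⟨b, -, h⟩ := H.exists_sqMass_le_exp
  refine lt_of_le_of_ne ENNReal.toReal_nonneg fun h0 => w.measure_ne_zero ?_
  rw [← Measure.measure_univ_eq_zero]
  refine measure_null_of_locally_null _ fun x _ =>
    ⟨Metric.ball x (r / 2), mem_nhdsWithin_of_mem_nhds (Metric.ball_mem_nhds x (by positivity)), ?_⟩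
  have h1 := h x z
  rw [← h0, mul_zero] at h1
  have h2 := w.measure_ball_le_sqMass (le_refl (r / 2)) x
  rwa [ENNReal.ofReal_of_nonpos h1, nonpos_iff_eq_zero] at h2

/-- Up to the factor v, the Gaussian at ξ is at most the integral over the disc of radius r/2 about
ξ of the wider Gaussian with exponent α/2. By Tonelli the mass of discs about u appears, and its
growth e^{b(|u-z|+1)} is integrable against the wider Gaussian. This estimate bounds the norm of the
test function in the lower bound for the kernel. -/
theorem exists_lintegral_gaussian_le (H : w.Regular r p K) {α : ℝ} (hα : 0 < α) :
    ∃ C : ℝ, 0 < C ∧ ∀ z : ℂ,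
      ∫⁻ ξ, ENNReal.ofReal (Real.exp (-α * ‖ξ - z‖ ^ 2)) ∂w.measure ≤
        ENNReal.ofReal (C * w.sqMass r z) := by
  have hr := H.pos
  obtain ⟨b, hb, hV⟩ := H.exists_sqMass_le_exp
  set I := ∫⁻ u : ℂ, ENNReal.ofReal (Real.exp (-(α / 2) * ‖u‖ ^ 2 + b * (‖u‖ + 1))) with hI
  have hIt : I ≠ ⊤ := lintegral_exp_neg_sq_add_linear_ne_top (half_pos hα)
  set v : ℝ≥0∞ := ENNReal.ofReal (Real.exp (-α * r ^ 2)) * volume (Metric.ball (0 : ℂ) (r / 2))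
    with hv
  have hv0 : v ≠ 0 := mul_ne_zero (by simp [Real.exp_pos])
    (Metric.measure_ball_pos volume (0 : ℂ) (half_pos hr)).ne'
  have hvt : v ≠ ⊤ := ENNReal.mul_ne_top ENNReal.ofReal_ne_top measure_ball_lt_top.ne
  have hIv : I / v ≠ ⊤ := ENNReal.div_ne_top hIt hv0
  have key : ∀ z : ℂ, v * ∫⁻ ξ, ENNReal.ofReal (Real.exp (-α * ‖ξ - z‖ ^ 2)) ∂w.measure ≤
      I * ENNReal.ofReal (w.sqMass r z) := by
    intro z
    set E : ℂ → ℝ≥0∞ := fun u => ENNReal.ofReal (Real.exp (-(α / 2) * ‖u - z‖ ^ 2)) with hE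
    have hEm : Measurable E := by
      have : Continuous fun u : ℂ => Real.exp (-(α / 2) * ‖u - z‖ ^ 2) := by fun_prop
      exact this.measurable.ennreal_ofReal
    have hS : MeasurableSet {q : ℂ × ℂ | dist q.2 q.1 < r / 2} :=
      (isOpen_lt (by fun_prop) continuous_const).measurableSet
    set F : ℂ → ℂ → ℝ≥0∞ := fun ξ u => {q : ℂ × ℂ | dist q.2 q.1 < r / 2}.indicator
      (fun q => E q.2) (ξ, u) with hF
    have hFm : Measurable (Function.uncurry F) :=
      (hEm.comp measurable_snd).indicator hS
    have hF1 : ∀ ξ, F ξ = (Metric.ball ξ (r / 2)).indicator E := fun ξ => rfl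
    have hF2 : ∀ u, (fun ξ => F ξ u) = (Metric.ball u (r / 2)).indicator fun _ => E u := by
      intro u
      ext ξ
      simp only [hF, Set.indicator, Set.mem_ofPred_eq, Metric.mem_ball, dist_comm ξ u]
    have hlow : ∀ ξ, v * ENNReal.ofReal (Real.exp (-α * ‖ξ - z‖ ^ 2)) ≤ ∫⁻ u, F ξ u := by
      intro ξ
      rw [hF1, lintegral_indicator Metric.isOpen_ball.measurableSet]
      calc v * ENNReal.ofReal (Real.exp (-α * ‖ξ - z‖ ^ 2))
          = ∫⁻ u in Metric.ball ξ (r / 2), ENNReal.ofReal (Real.exp (-α * r ^ 2)) *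
            ENNReal.ofReal (Real.exp (-α * ‖ξ - z‖ ^ 2)) := by
            rw [setLIntegral_const, Measure.addHaar_ball_center, hv]; ring
        _ ≤ _ := by
            refine setLIntegral_mono hEm fun u hu => ?_
            rw [← ENNReal.ofReal_mul (Real.exp_pos _).le, ← Real.exp_add]
            refine ENNReal.ofReal_le_ofReal (Real.exp_le_exp.2 ?_)
            rw [Metric.mem_ball, Complex.dist_eq] at hu
            have h1 : ‖u - z‖ ≤ r + ‖ξ - z‖ := by
              have := norm_add_le (u - ξ) (ξ - z)
              rw [sub_add_sub_cancel] at this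
              linarith
            have h2 : ‖u - z‖ ^ 2 ≤ 2 * r ^ 2 + 2 * ‖ξ - z‖ ^ 2 := by
              nlinarith [norm_nonneg (u - z), norm_nonneg (ξ - z), sq_nonneg (r - ‖ξ - z‖)]
            nlinarith
    calc v * ∫⁻ ξ, ENNReal.ofReal (Real.exp (-α * ‖ξ - z‖ ^ 2)) ∂w.measure
        = ∫⁻ ξ, v * ENNReal.ofReal (Real.exp (-α * ‖ξ - z‖ ^ 2)) ∂w.measure := by
          rw [lintegral_const_mul' _ _ hvt]
      _ ≤ ∫⁻ ξ, (∫⁻ u, F ξ u) ∂w.measure := lintegral_mono hlow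
      _ = ∫⁻ u, ∫⁻ ξ, F ξ u ∂w.measure := lintegral_lintegral_swap hFm.aemeasurable
      _ = ∫⁻ u, E u * w.measure (Metric.ball u (r / 2)) := by
          refine lintegral_congr fun u => ?_
          rw [hF2, lintegral_indicator Metric.isOpen_ball.measurableSet, setLIntegral_const]
      _ ≤ ∫⁻ u, ENNReal.ofReal (Real.exp (-(α / 2) * ‖u - z‖ ^ 2 + b * (‖u - z‖ + 1))) *
            ENNReal.ofReal (w.sqMass r z) := by
          refine lintegral_mono fun u => ?_
          calc E u * w.measure (Metric.ball u (r / 2))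
              ≤ E u * ENNReal.ofReal (Real.exp (b * (‖u - z‖ + 1)) * w.sqMass r z) := by
                gcongr
                exact (w.measure_ball_le_sqMass le_rfl u).trans
                  (ENNReal.ofReal_le_ofReal (hV u z))
            _ = _ := by
                rw [hE, ENNReal.ofReal_mul (Real.exp_pos _).le, ← mul_assoc,
                  ← ENNReal.ofReal_mul (Real.exp_pos _).le, ← Real.exp_add]
      _ = I * ENNReal.ofReal (w.sqMass r z) := by
          rw [lintegral_mul_const' _ _ ENNReal.ofReal_ne_top, hI]
          congr 1
          exact lintegral_sub_right_eq_self (fun u : ℂ => ENNReal.ofReal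
            (Real.exp (-(α / 2) * ‖u‖ ^ 2 + b * (‖u‖ + 1)))) z
  refine ⟨(I / v).toReal + 1, by positivity, fun z => ?_⟩
  rw [ENNReal.ofReal_mul (by positivity)]
  have h2 : ∫⁻ ξ, ENNReal.ofReal (Real.exp (-α * ‖ξ - z‖ ^ 2)) ∂w.measure ≤
      I / v * ENNReal.ofReal (w.sqMass r z) := by
    rw [← ENNReal.mul_div_right_comm]
    exact (ENNReal.le_div_iff_mul_le (Or.inl hv0) (Or.inl hvt)).2 ((mul_comm _ _).trans_le (key z))
  refine h2.trans ?_
  gcongr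
  rw [ENNReal.le_ofReal_iff_toReal_le hIv (by positivity)]
  linarith

end Regular

end Weight

/-! ### Subharmonicity of powers of |f| -/

open Real in
-- Jensen's formula: the excess of the circle average is a sum over the zeros u in the disc of
-- multiplicity times log(R/|c - u|), with nonnegative terms.
theorem log_norm_le_circleAverage {f : ℂ → ℂ} (hf : Differentiable ℂ f) {c : ℂ} (hc : f c ≠ 0)
    {R : ℝ} (hR : 0 < R) : log ‖f c‖ ≤ circleAverage (fun z => log ‖f z‖) c R := by
  have han : AnalyticOnNhd ℂ f (Metric.closedBall c |R|) := fun z _ => hf.analyticAt z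
  rw [han.circleAverage_log_norm hR.ne' hc, le_add_iff_nonneg_left]
  refine finsum_nonneg fun u => ?_
  by_cases hu : u ∈ Metric.closedBall c |R|
  · refine mul_nonneg (mod_cast MeromorphicOn.AnalyticOnNhd.divisor_nonneg han u) ?_
    rcases eq_or_ne u c with rfl | hne
    · simp
    · refine log_nonneg ?_
      have h1 : 0 < ‖c - u‖ := norm_pos_iff.2 (sub_ne_zero.2 hne.symm)
      rw [← div_eq_mul_inv, one_le_div h1, ← Complex.dist_eq, dist_comm]
      rwa [Metric.mem_closedBall, abs_of_pos hR] at hu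
  · simp [hu]

open Real in
/-- The function `‖f‖ ^ t` is subharmonic. -/
theorem norm_rpow_le_circleAverage {f : ℂ → ℂ} (hf : Differentiable ℂ f) (c : ℂ)
    {R t : ℝ} (hR : 0 < R) (ht : 0 < t) :
    ‖f c‖ ^ t ≤ circleAverage (fun z => ‖f z‖ ^ t) c R := by
  have hcont : Continuous fun z => ‖f z‖ ^ t :=
    (hf.continuous.norm).rpow_const fun _ => Or.inr ht.le
  rcases eq_or_ne (f c) 0 with h0 | h0
  · rw [h0, norm_zero, zero_rpow ht.ne']
    refine circleAverage_nonneg_of_nonneg fun z _ => by positivity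
  have hc : 0 < ‖f c‖ := norm_pos_iff.2 h0
  set A := ‖f c‖ ^ t with hA
  have hApos : 0 < A := by positivity
  have hmer : MeromorphicOn f (Metric.sphere c |R|) := fun z _ => (hf.analyticAt z).meromorphicAt
  have hli := hmer.circleIntegrable_log_norm
  -- |f|^t is exp(t log|f|), and L is the tangent line of this exponential at log|f(c)|, so L ≤
  -- |f|^t off the zeros of f by 1 + x ≤ exp x.
  set L : ℂ → ℝ := ((A * t) • fun z => log ‖f z‖) + fun _ => A * (1 - t * log ‖f c‖) with hL
  have hL' : ∀ z, L z = A * (1 + t * (log ‖f z‖ - log ‖f c‖)) := fun z => by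
    simp only [hL, Pi.add_apply, Pi.smul_apply, smul_eq_mul]; ring
  -- At zeros of f the convention log 0 = 0 can make L exceed |f|^t = 0. Changing the values on this
  -- discrete set restores the inequality and leaves the circle average unchanged.
  set M : ℂ → ℝ := fun z => if f z = 0 then L z else ‖f z‖ ^ t with hM
  have hLi : CircleIntegrable L c R := hli.const_smul.add (circleIntegrable_const _ _ _)
  have hcod : M =ᶠ[codiscreteWithin (Metric.sphere c |R|)] fun z => ‖f z‖ ^ t := by
    have han : AnalyticOnNhd ℂ f Set.univ := fun z _ => hf.analyticAt z
    have := han.preimage_zero_mem_codiscrete (x := c) h0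
    have h2 : f ⁻¹' {0}ᶜ ∈ codiscreteWithin (Metric.sphere c |R|) :=
      codiscreteWithin_mono (Set.subset_univ _) this
    filter_upwards [h2] with z hz
    have : f z ≠ 0 := hz
    simp [hM, this]
  have hLM : ∀ z, L z ≤ M z := by
    intro z
    by_cases hz : f z = 0
    · simp [hM, hz]
    · simp only [hM, hz, if_false, hL']
      have hzp : 0 < ‖f z‖ := norm_pos_iff.2 hz
      have e : ‖f z‖ ^ t = A * exp (t * (log ‖f z‖ - log ‖f c‖)) := by
        rw [hA, rpow_def_of_pos hzp, rpow_def_of_pos hc, ← exp_add]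
        congr 1; ring
      rw [e]
      gcongr
      linarith [add_one_le_exp (t * (log ‖f z‖ - log ‖f c‖))]
  have hMi : CircleIntegrable M c R :=
    (CircleIntegrable.congr_codiscreteWithin hcod.symm
      hcont.continuousOn.circleIntegrable')
  have h1 : circleAverage L c R ≤ circleAverage M c R :=
    circleAverage_mono hLi hMi fun z _ => hLM z
  rw [circleAverage_congr_codiscreteWithin hcod hR.ne'] at h1
  refine le_trans ?_ h1
  have h2 := log_norm_le_circleAverage hf h0 hR
  have e : circleAverage L c R =
      A * (1 + t * (circleAverage (fun z => log ‖f z‖) c R - log ‖f c‖)) := by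
    rw [hL, circleAverage_add hli.const_smul (circleIntegrable_const _ _ _), circleAverage_smul,
      circleAverage_const, smul_eq_mul]
    ring
  rw [e]
  nlinarith [mul_nonneg hApos.le (mul_nonneg ht.le (sub_nonneg.2 h2))]

/-- The mean value inequality for `‖f‖ ^ t` on discs. -/
theorem volume_mul_enorm_rpow_le {f : ℂ → ℂ} (hf : Differentiable ℂ f) (c : ℂ) {t : ℝ}
    (ht : 0 < t) (s : ℝ) :
    volume (Metric.ball (0 : ℂ) s) * ‖f c‖ₑ ^ t ≤ ∫⁻ z in Metric.ball c s, ‖f z‖ₑ ^ t := by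
  have hcont : Continuous fun z => ‖f z‖ ^ t :=
    (hf.continuous.norm).rpow_const fun _ => Or.inr ht.le
  have hen : ∀ z, ‖f z‖ₑ ^ t = ENNReal.ofReal (‖f z‖ ^ t) := fun z => by
    rw [← ofReal_norm, ENNReal.ofReal_rpow_of_nonneg (norm_nonneg _) ht.le]
  have hbm : MeasurableSet (Metric.ball (0 : ℂ) s) := Metric.isOpen_ball.measurableSet
  have e1 : ∫⁻ z in Metric.ball c s, ‖f z‖ₑ ^ t =
      ∫⁻ z, (Metric.ball (0 : ℂ) s).indicator (fun z => ‖f (z + c)‖ₑ ^ t) z := by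
    rw [← lintegral_indicator Metric.isOpen_ball.measurableSet,
      ← lintegral_add_right_eq_self _ c]
    refine lintegral_congr fun z => ?_
    simp [Set.indicator, Metric.mem_ball, dist_eq_norm]
  have e2 : volume (Metric.ball (0 : ℂ) s) * ‖f c‖ₑ ^ t =
      ∫⁻ z, (Metric.ball (0 : ℂ) s).indicator (fun _ => ‖f c‖ₑ ^ t) z := by
    rw [lintegral_indicator hbm, setLIntegral_const, mul_comm]
  have hpol : Continuous fun q : ℝ × ℝ => Complex.polarCoord.symm q := by
    simp only [Complex.polarCoord_symm_apply]
    fun_prop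
  rw [e1, e2, ← Complex.lintegral_comp_polarCoord_symm, ← Complex.lintegral_comp_polarCoord_symm,
    polarCoord_target, Measure.volume_eq_prod, ← Measure.prod_restrict]
  have hmeas : ∀ g : ℂ → ℝ≥0∞, Measurable g → Measurable fun q : ℝ × ℝ => ENNReal.ofReal q.1 •
      (Metric.ball (0 : ℂ) s).indicator g (Complex.polarCoord.symm q) := fun g hg =>
    measurable_fst.ennreal_ofReal.smul ((hg.indicator hbm).comp hpol.measurable)
  have hfm : Measurable fun z => ‖f (z + c)‖ₑ ^ t := by
    simp only [hen]
    exact (hcont.comp (by fun_prop : Continuous fun z : ℂ => z + c)).measurable.ennreal_ofReal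
  rw [lintegral_prod _ (hmeas _ measurable_const).aemeasurable,
    lintegral_prod _ (hmeas _ hfm).aemeasurable]
  refine setLIntegral_mono' measurableSet_Ioi fun ρ hρ => ?_
  have hρ : 0 < ρ := hρ
  simp only [smul_eq_mul]
  rw [lintegral_const_mul' _ _ ENNReal.ofReal_ne_top, lintegral_const_mul' _ _ ENNReal.ofReal_ne_top]
  refine mul_le_mul' le_rfl ?_
  have hmem : ∀ θ : ℝ, Complex.polarCoord.symm (ρ, θ) ∈ Metric.ball (0 : ℂ) s ↔ ρ < s := by
    intro θ
    rw [mem_ball_zero_iff, Complex.norm_polarCoord_symm, abs_of_pos hρ]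
  by_cases hs : ρ < s
  swap
  · simp only [Set.indicator, hmem, hs, if_false, lintegral_zero, le_refl]
  simp only [Set.indicator, hmem, hs, if_true, hen]
  have hcm : ∀ θ : ℝ, Complex.polarCoord.symm (ρ, θ) + c = circleMap c ρ θ := by
    intro θ
    rw [Complex.polarCoord_symm_apply, circleMap, Complex.exp_mul_I]
    push_cast
    ring
  simp only [hcm]
  have hcc : Continuous fun θ => ‖f (circleMap c ρ θ)‖ ^ t := hcont.comp (continuous_circleMap c ρ)
  have hpi := Real.pi_pos
  have hav := norm_rpow_le_circleAverage hf c hρ ht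
  have hper : Function.Periodic (fun θ => ‖f (circleMap c ρ θ)‖ ^ t) (2 * Real.pi) := fun θ => by
    simp only [periodic_circleMap c ρ θ]
  rw [Real.circleAverage_def, smul_eq_mul, inv_mul_eq_div, le_div_iff₀ (by positivity)] at hav
  have hint := hper.intervalIntegral_add_eq 0 (-Real.pi)
  rw [zero_add, show -Real.pi + 2 * Real.pi = Real.pi by ring] at hint
  rw [hint, intervalIntegral.integral_of_le (by linarith), integral_Ioc_eq_integral_Ioo] at hav
  rw [← ofReal_integral_eq_lintegral_ofReal ((hcc.integrableOn_Icc).mono_set Set.Ioo_subset_Icc_self)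
    (Eventually.of_forall fun θ => by positivity), setLIntegral_const, Real.volume_Ioo,
    ← ENNReal.ofReal_mul (by positivity)]
  refine ENNReal.ofReal_le_ofReal ?_
  linarith

/-! ### The local pointwise estimate for entire functions -/

/-- The zero-free entire function `ξ ↦ exp (α (|z|² / 2 - ξ z̄))`. -/
def twist (α : ℝ) (z ξ : ℂ) : ℂ :=
  Complex.exp (α * (‖z‖ ^ 2 / 2 - ξ * conj z))

theorem differentiable_twist (α : ℝ) (z : ℂ) : Differentiable ℂ (twist α z) := by
  unfold twist
  fun_prop

theorem norm_twist (α : ℝ) (z ξ : ℂ) :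
    ‖twist α z ξ‖ = Real.exp (α / 2 * (‖ξ - z‖ ^ 2 - ‖ξ‖ ^ 2)) := by
  rw [twist, Complex.norm_exp]
  congr 1
  have h : ((‖z‖ : ℂ) ^ 2 / 2 - ξ * conj z) =
      (((‖z‖ ^ 2 / 2 - (ξ.re * z.re + ξ.im * z.im) : ℝ)) : ℂ) +
        (((ξ.re * z.im - ξ.im * z.re : ℝ)) : ℂ) * Complex.I := by
    apply Complex.ext
    · simp [← Complex.ofReal_pow]
    · simp [← Complex.ofReal_pow]
      ring
  rw [h, Complex.re_ofReal_mul, Complex.sq_norm, Complex.sq_norm, Complex.sq_norm]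
  simp [Complex.normSq_apply]
  ring

/-- Hence |f|²e^{-α|·|²} is, near z, comparable to the squared modulus of an entire function: the
factor e^{α|ξ-z|²} is 1 at z and bounded on discs about z, uniformly in z. -/
theorem norm_mul_twist_sq (α : ℝ) (z ξ a : ℂ) :
    ‖a * twist α z ξ‖ ^ 2 = ‖a‖ ^ 2 * Real.exp (-α * ‖ξ‖ ^ 2) * Real.exp (α * ‖ξ - z‖ ^ 2) := by
  rw [norm_mul, norm_twist, mul_pow, ← Real.exp_nat_mul, mul_assoc, ← Real.exp_add]
  congr 2
  push_cast
  ring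

theorem enorm_sq_eq_ofReal (a : ℂ) : ‖a‖ₑ ^ 2 = ENNReal.ofReal (‖a‖ ^ 2) := by
  rw [ENNReal.ofReal_pow (norm_nonneg _), ofReal_norm]

namespace Weight

theorem gaussMeasure_eq (w : Weight) (α : ℝ) : w.gaussMeasure α =
    w.measure.withDensity fun z => ENNReal.ofReal (Real.exp (-α * ‖z‖ ^ 2)) := by
  have h1 : Continuous fun z : ℂ => Real.exp (-α * ‖z‖ ^ 2) := by fun_prop
  rw [measure, ← withDensity_mul₀ w.aemeasurable.ennreal_ofReal
    h1.measurable.ennreal_ofReal.aemeasurable, gaussMeasure]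
  congr 1
  ext z
  rw [Pi.mul_apply, ENNReal.ofReal_mul (Real.exp_pos _).le, mul_comm]

theorem setLIntegral_gaussMeasure (w : Weight) (α : ℝ) {F : ℂ → ℝ≥0∞} (hF : Measurable F)
    {S : Set ℂ} (hS : MeasurableSet S) :
    ∫⁻ z in S, F z ∂w.gaussMeasure α =
      ∫⁻ z in S, ENNReal.ofReal (Real.exp (-α * ‖z‖ ^ 2)) * F z ∂w.measure := by
  have h1 : Continuous fun z : ℂ => Real.exp (-α * ‖z‖ ^ 2) := by fun_prop
  rw [gaussMeasure_eq, setLIntegral_withDensity_eq_setLIntegral_mul _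
    h1.measurable.ennreal_ofReal hF hS]
  rfl

/-- The Hölder inequality on the square, with h equal to |f · twist|² on the disc, turns the
unweighted integral of |f · twist|^(2/p) into the weighted energy. The mean value inequality bounds
the former from below; the exponent 2/p may be less than 1, so subharmonicity is needed for all
positive powers. -/
theorem Regular.exists_pointwise_le {w : Weight} {r p : ℝ} {K : ℝ≥0∞} (H : w.Regular r p K)
    {α : ℝ} (hα : 0 < α) {s : ℝ} (hs : 0 < s) (hsr : s ≤ r / 2) :
    ∃ C : ℝ, 0 < C ∧ ∀ f : ℂ → ℂ, Differentiable ℂ f → ∀ z : ℂ,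
      ENNReal.ofReal (w.sqMass r z * (‖f z‖ ^ 2 * Real.exp (-α * ‖z‖ ^ 2))) ≤
        ENNReal.ofReal C * ∫⁻ ξ in Metric.ball z s, ‖f ξ‖ₑ ^ 2 ∂w.gaussMeasure α := by
  have hp := H.one_lt
  have hp0 : 0 < p := by linarith
  set v : ℝ≥0∞ := volume (Metric.ball (0 : ℂ) s) ^ p
  have hv0 : v ≠ 0 := by
    have := (Metric.measure_ball_pos volume (0 : ℂ) hs).ne'
    simp only [v, ne_eq, ENNReal.rpow_eq_zero_iff, this, measure_ball_lt_top.ne]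
    simp
  have hvt : v ≠ ⊤ := ENNReal.rpow_ne_top_of_nonneg hp0.le measure_ball_lt_top.ne
  set K' : ℝ≥0∞ := K * ENNReal.ofReal (Real.exp (α * s ^ 2)) / v with hK'
  have hKv : K' ≠ ⊤ := ENNReal.div_ne_top (ENNReal.mul_ne_top H.ne_top ENNReal.ofReal_ne_top) hv0
  refine ⟨K'.toReal + 1, by positivity, fun f hf z => ?_⟩
  have hbm : MeasurableSet (Metric.ball z s) := Metric.isOpen_ball.measurableSet
  have hsub : Metric.ball z s ⊆ square z r :=
    (Metric.ball_subset_ball hsr).trans (ball_subset_square z r)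
  set g : ℂ → ℂ := fun ξ => f ξ * twist α z ξ with hg
  have hgd : Differentiable ℂ g := hf.mul (differentiable_twist α z)
  have hgm : Measurable fun ξ => ‖g ξ‖ₑ ^ 2 := hgd.continuous.measurable.enorm.pow_const 2
  have h := H.bound z ((Metric.ball z s).indicator fun ξ => ‖g ξ‖ₑ ^ 2) (hgm.indicator hbm)
  have e : ∀ ξ, (Metric.ball z s).indicator (fun ξ => ‖g ξ‖ₑ ^ 2) ξ ^ (1 / p) =
      (Metric.ball z s).indicator (fun ξ => ‖g ξ‖ₑ ^ (2 / p)) ξ := by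
    intro ξ
    by_cases hξ : ξ ∈ Metric.ball z s
    · simp only [hξ, Set.indicator_of_mem]
      rw [← ENNReal.rpow_two, ← ENNReal.rpow_mul]
      congr 1; ring
    · simp only [hξ, not_false_eq_true, Set.indicator_of_notMem]
      exact ENNReal.zero_rpow_of_pos (by positivity)
  simp only [e] at h
  rw [setLIntegral_indicator hbm, setLIntegral_indicator hbm, Set.inter_eq_left.2 hsub] at h
  have h1 := volume_mul_enorm_rpow_le hgd z (t := 2 / p) (by positivity) s
  have h2 : w.measure (square z r) * (v * ‖g z‖ₑ ^ 2) ≤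
      K * ∫⁻ ξ in Metric.ball z s, ‖g ξ‖ₑ ^ 2 ∂w.measure := by
    refine le_trans ?_ h
    gcongr
    refine le_trans (le_of_eq ?_) (ENNReal.rpow_le_rpow h1 hp0.le)
    rw [ENNReal.mul_rpow_of_nonneg _ _ hp0.le, ← ENNReal.rpow_mul, div_mul_cancel₀ _ hp0.ne',
      ENNReal.rpow_two]
  have hge : ∀ ξ, ‖g ξ‖ₑ ^ 2 = ENNReal.ofReal (Real.exp (α * ‖ξ - z‖ ^ 2)) *
      (ENNReal.ofReal (Real.exp (-α * ‖ξ‖ ^ 2)) * ‖f ξ‖ₑ ^ 2) := by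
    intro ξ
    rw [enorm_sq_eq_ofReal, enorm_sq_eq_ofReal, norm_mul_twist_sq,
      ← ENNReal.ofReal_mul (Real.exp_pos _).le, ← ENNReal.ofReal_mul (Real.exp_pos _).le]
    congr 1; ring
  have hfm : Measurable fun ξ => ‖f ξ‖ₑ ^ 2 := hf.continuous.measurable.enorm.pow_const 2
  have h3 : ∫⁻ ξ in Metric.ball z s, ‖g ξ‖ₑ ^ 2 ∂w.measure ≤
      ENNReal.ofReal (Real.exp (α * s ^ 2)) *
        ∫⁻ ξ in Metric.ball z s, ‖f ξ‖ₑ ^ 2 ∂w.gaussMeasure α := by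
    rw [w.setLIntegral_gaussMeasure α hfm hbm, ← lintegral_const_mul' _ _ ENNReal.ofReal_ne_top]
    refine setLIntegral_mono' hbm fun ξ hξ => ?_
    rw [hge]
    rw [Metric.mem_ball, Complex.dist_eq] at hξ
    gcongr
  have h4 : ENNReal.ofReal (w.sqMass r z * (‖f z‖ ^ 2 * Real.exp (-α * ‖z‖ ^ 2))) =
      w.measure (square z r) * ‖g z‖ₑ ^ 2 := by
    rw [ENNReal.ofReal_mul (H.sqMass_pos z).le, w.ofReal_sqMass, enorm_sq_eq_ofReal,
      norm_mul_twist_sq]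
    simp
  rw [h4]
  have h5 : w.measure (square z r) * ‖g z‖ₑ ^ 2 ≤
      K' * ∫⁻ ξ in Metric.ball z s, ‖f ξ‖ₑ ^ 2 ∂w.gaussMeasure α := by
    rw [hK', ← ENNReal.mul_div_right_comm]
    refine (ENNReal.le_div_iff_mul_le (Or.inl hv0) (Or.inl hvt)).2 ?_
    calc w.measure (square z r) * ‖g z‖ₑ ^ 2 * v
        = w.measure (square z r) * (v * ‖g z‖ₑ ^ 2) := by ring
      _ ≤ _ := h2
      _ ≤ _ := by rw [mul_assoc]; gcongr
  refine h5.trans ?_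
  gcongr
  rw [ENNReal.le_ofReal_iff_toReal_le hKv (by positivity)]
  linarith

end Weight

/-! ### Completeness, reproducing kernels, and their size on the diagonal -/

namespace FockSpace

variable {α : ℝ} {w : Weight}

@[simp] theorem sub_apply (f g : FockSpace α w) (z : ℂ) : (f - g) z = f z - g z := rfl

@[simp] theorem smul_apply (c : ℂ) (f : FockSpace α w) (z : ℂ) : (c • f) z = c * f z := rfl

theorem differentiable (f : FockSpace α w) : Differentiable ℂ f.1 := f.2.1

theorem continuous (f : FockSpace α w) : Continuous f.1 := f.2.1.continuous

theorem norm_toL2 (f : FockSpace α w) : ‖toL2 f‖ = ‖f‖ := rfl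

theorem enorm_sq_eq_lintegral (f : FockSpace α w) :
    ‖f‖ₑ ^ 2 = ∫⁻ ξ, ‖f ξ‖ₑ ^ 2 ∂w.gaussMeasure α := by
  have h1 : ‖f‖ₑ = eLpNorm f.1 2 (w.gaussMeasure α) := by
    rw [← ofReal_norm, ← norm_toL2, ofReal_norm]
    exact Lp.enorm_toLp f.2.2
  have h2 := eLpNorm_nnreal_pow_eq_lintegral (μ := w.gaussMeasure α) (f := f.1) (p := 2)
    two_ne_zero
  rw [h1]
  simpa using h2

theorem ofReal_norm_sq (f : FockSpace α w) :
    ENNReal.ofReal (‖f‖ ^ 2) = ∫⁻ ξ, ‖f ξ‖ₑ ^ 2 ∂w.gaussMeasure α := by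
  rw [← enorm_sq_eq_lintegral, ENNReal.ofReal_pow (norm_nonneg _), ofReal_norm]

variable {r p : ℝ} {K : ℝ≥0∞}

theorem exists_pointwise_le (H : w.Regular r p K) (hα : 0 < α) :
    ∃ C : ℝ, 0 < C ∧ ∀ (f : FockSpace α w) (z : ℂ),
      w.sqMass r z * (‖f z‖ ^ 2 * Real.exp (-α * ‖z‖ ^ 2)) ≤ C * ‖f‖ ^ 2 := by
  obtain ⟨C, hC, h⟩ := H.exists_pointwise_le hα (half_pos H.pos) le_rfl
  refine ⟨C, hC, fun f z => ?_⟩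
  rw [← ENNReal.ofReal_le_ofReal_iff (by positivity), ENNReal.ofReal_mul hC.le, ofReal_norm_sq]
  refine (h f f.differentiable z).trans ?_
  gcongr
  exact Measure.restrict_le_self

/-- On a bounded disc the growth estimate bounds `sqMass` from below. The uniformity in z makes norm
convergence imply locally uniform convergence. -/
theorem exists_norm_apply_le (H : w.Regular r p K) (hα : 0 < α) (R : ℝ) :
    ∃ M : ℝ, 0 < M ∧ ∀ z : ℂ, ‖z‖ ≤ R → ∀ f : FockSpace α w, ‖f z‖ ≤ M * ‖f‖ := by
  obtain ⟨C, hC, h⟩ := exists_pointwise_le (α := α) H hα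
  obtain ⟨b, hb, hV⟩ := H.exists_sqMass_le_exp
  set v := w.sqMass r 0 * Real.exp (-(b * (R + 1))) * Real.exp (-α * R ^ 2) with hv
  have hv0 : 0 < v := by have := H.sqMass_pos 0; positivity
  refine ⟨√(C / v), by positivity, fun z hz f => ?_⟩
  have h1 := hV 0 z
  have hR : 0 ≤ R := (norm_nonneg z).trans hz
  have h2 : w.sqMass r 0 * Real.exp (-(b * (R + 1))) ≤ w.sqMass r z := by
    rw [Real.exp_neg, ← div_eq_mul_inv, div_le_iff₀ (Real.exp_pos _), mul_comm]
    refine h1.trans (mul_le_mul_of_nonneg_right (Real.exp_le_exp.2 ?_) ENNReal.toReal_nonneg)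
    rw [zero_sub, norm_neg]
    gcongr
  have h3 : Real.exp (-α * R ^ 2) ≤ Real.exp (-α * ‖z‖ ^ 2) := by
    refine Real.exp_le_exp.2 ?_
    rw [neg_mul, neg_mul, neg_le_neg_iff]
    gcongr
  have h4 : v * ‖f z‖ ^ 2 ≤ C * ‖f‖ ^ 2 := by
    refine le_trans ?_ (h f z)
    calc v * ‖f z‖ ^ 2 ≤ (w.sqMass r z * Real.exp (-α * ‖z‖ ^ 2)) * ‖f z‖ ^ 2 := by
          have := (H.sqMass_pos z).le
          gcongr
          rw [hv]
          gcongr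
      _ = _ := by ring
  refine le_of_sq_le_sq ?_ (by positivity)
  rw [mul_pow, Real.sq_sqrt (by positivity), div_mul_eq_mul_div, le_div_iff₀ hv0]
  linarith

/-- Point evaluation. -/
def eval (H : w.Regular r p K) (hα : 0 < α) (z : ℂ) : FockSpace α w →L[ℂ] ℂ :=
  LinearMap.mkContinuousOfExistsBound
    { toFun := fun f => f z, map_add' := fun _ _ => rfl, map_smul' := fun _ _ => rfl }
    (let ⟨M, _, h⟩ := exists_norm_apply_le H hα ‖z‖
    ⟨M, h z le_rfl⟩)

theorem completeSpace (H : w.Regular r p K) (hα : 0 < α) : CompleteSpace (FockSpace α w) := by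
  refine Metric.complete_of_cauchySeq_tendsto fun u hu => ?_
  have hpt : ∀ z, ∃ a, Tendsto (fun n => u n z) atTop (𝓝 a) := fun z =>
    cauchySeq_tendsto_of_complete ((eval H hα z).uniformContinuous.comp_cauchySeq hu)
  choose F hF using hpt
  have hloc : TendstoLocallyUniformly (fun n => (u n).1) F atTop := by
    rw [Metric.tendstoLocallyUniformly_iff]
    intro ε hε x
    obtain ⟨M, hM, h⟩ := exists_norm_apply_le (α := α) H hα (‖x‖ + 1)
    refine ⟨Metric.ball x 1, Metric.ball_mem_nhds x one_pos, ?_⟩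
    obtain ⟨N, hN⟩ := Metric.cauchySeq_iff'.1 hu (ε / (4 * M)) (by positivity)
    filter_upwards [eventually_ge_atTop N] with n hn y hy
    have hy' : ‖y‖ ≤ ‖x‖ + 1 := by
      rw [Metric.mem_ball, Complex.dist_eq] at hy
      have := norm_add_le x (y - x)
      rw [add_sub_cancel] at this
      linarith
    have hb : ∀ m, N ≤ m → ‖u m y - u n y‖ ≤ ε / 2 := by
      intro m hm
      have h1 := h y hy' (u m - u n)
      rw [sub_apply] at h1
      refine h1.trans ?_
      rw [← dist_eq_norm]
      have h2 : dist (u m) (u n) ≤ ε / (4 * M) + ε / (4 * M) :=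
        (dist_triangle_right _ _ (u N)).trans (add_le_add (hN m hm).le (hN n hn).le)
      calc M * dist (u m) (u n) ≤ M * (ε / (4 * M) + ε / (4 * M)) := by gcongr
        _ = ε / 2 := by field_simp; ring
    have hlim : Tendsto (fun m => ‖u m y - u n y‖) atTop (𝓝 ‖F y - u n y‖) :=
      ((hF y).sub_const _).norm
    have := le_of_tendsto hlim ((eventually_ge_atTop N).mono hb)
    rw [dist_eq_norm]
    change ‖F y - u n y‖ < ε
    linarith
  have hFd : Differentiable ℂ F := by
    rw [← differentiableOn_univ]
    exact (tendstoLocallyUniformlyOn_univ.2 hloc).differentiableOn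
      (Eventually.of_forall fun n => (u n).differentiable.differentiableOn) isOpen_univ
  have hcau : CauchySeq fun n => toL2 (u n) := by
    rw [Metric.cauchySeq_iff'] at hu ⊢
    intro ε hε
    obtain ⟨N, hN⟩ := hu ε hε
    refine ⟨N, fun n hn => ?_⟩
    have := hN n hn
    rwa [dist_eq_norm, ← norm_toL2, map_sub, ← dist_eq_norm] at this
  obtain ⟨g, hg⟩ := cauchySeq_tendsto_of_complete hcau
  -- An almost everywhere convergent subsequence identifies the L² limit g with the entire pointwise
  -- limit F.
  obtain ⟨ns, hns, hae⟩ := (tendstoInMeasure_of_tendsto_Lp hg).exists_seq_tendsto_ae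
  have hcoe : ∀ᵐ z ∂w.gaussMeasure α, ∀ n, toL2 (u n) z = u n z :=
    ae_all_iff.2 fun n => (u n).2.2.coeFn_toLp
  have hFg : F =ᵐ[w.gaussMeasure α] g := by
    filter_upwards [hae, hcoe] with z h1 h2
    refine tendsto_nhds_unique ?_ h1
    simp only [h2]
    exact (hF z).comp hns.tendsto_atTop
  have hmem : MemLp F 2 (w.gaussMeasure α) := (memLp_congr_ae hFg).2 (Lp.memLp g)
  obtain ⟨G, hG⟩ : ∃ G : FockSpace α w, G.1 = F := ⟨⟨F, hFd, hmem⟩, rfl⟩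
  have hFL : toL2 G = g := by
    refine Lp.ext (G.2.2.coeFn_toLp.trans ?_)
    rw [hG]
    exact hFg
  refine ⟨G, ?_⟩
  rw [tendsto_iff_norm_sub_tendsto_zero] at hg ⊢
  refine hg.congr fun n => ?_
  rw [← hFL, ← map_sub, norm_toL2]

theorem isReproducingKernelAt_kernel (H : w.Regular r p K) (hα : 0 < α) (z : ℂ) :
    IsReproducingKernelAt z (kernel α w z) := by
  have := completeSpace (α := α) H hα
  refine Classical.epsilon_spec (p := IsReproducingKernelAt z)
    ⟨(InnerProductSpace.toDual ℂ (FockSpace α w)).symm (eval H hα z), fun f => ?_⟩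
  rw [InnerProductSpace.toDual_symm_apply]
  rfl

theorem inner_kernel (H : w.Regular r p K) (hα : 0 < α) (z : ℂ) (f : FockSpace α w) :
    inner ℂ (kernel α w z) f = f z :=
  (isReproducingKernelAt_kernel H hα z f).symm

theorem kernel_apply_self (H : w.Regular r p K) (hα : 0 < α) (z : ℂ) :
    kernel α w z z = ((‖kernel α w z‖ ^ 2 : ℝ) : ℂ) := by
  rw [← inner_kernel H hα, inner_self_eq_norm_sq_to_K]
  norm_cast

theorem norm_apply_le (H : w.Regular r p K) (hα : 0 < α) (z : ℂ) (f : FockSpace α w) :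
    ‖f z‖ ≤ ‖kernel α w z‖ * ‖f‖ := by
  rw [← inner_kernel H hα]
  exact norm_inner_le_norm _ _

/-- Upper bound for the reproducing kernel on the diagonal. -/
theorem exists_norm_kernel_sq_le (H : w.Regular r p K) (hα : 0 < α) :
    ∃ C : ℝ, 0 < C ∧ ∀ z : ℂ,
      ‖kernel α w z‖ ^ 2 * Real.exp (-α * ‖z‖ ^ 2) * w.sqMass r z ≤ C := by
  obtain ⟨C, hC, h⟩ := exists_pointwise_le (α := α) H hα
  refine ⟨C, hC, fun z => ?_⟩
  -- As B_z(z) = ‖B_z‖², the left side carries ‖B_z‖⁴ and the right side ‖B_z‖²; one factor cancels.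
  have h1 := h (kernel α w z) z
  rw [kernel_apply_self H hα, Complex.norm_real, Real.norm_of_nonneg (by positivity)] at h1
  rcases eq_or_ne (‖kernel α w z‖ ^ 2) 0 with h0 | h0
  · rw [h0]; simpa using hC.le
  · have h2 : 0 < ‖kernel α w z‖ ^ 2 := lt_of_le_of_ne (by positivity) h0.symm
    refine le_of_mul_le_mul_right ?_ h2
    calc _ = w.sqMass r z * ((‖kernel α w z‖ ^ 2) ^ 2 * Real.exp (-α * ‖z‖ ^ 2)) := by ring
      _ ≤ _ := h1

/-- Lower bound for the reproducing kernel on the diagonal. -/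
theorem exists_le_norm_kernel_sq (H : w.Regular r p K) (hα : 0 < α) :
    ∃ C : ℝ, 0 < C ∧ ∀ z : ℂ,
      1 ≤ C * (‖kernel α w z‖ ^ 2 * Real.exp (-α * ‖z‖ ^ 2) * w.sqMass r z) := by
  obtain ⟨C, hC, h⟩ := H.exists_lintegral_gaussian_le hα
  refine ⟨C, hC, fun z => ?_⟩
  -- The test function is the normalized kernel of the unweighted Fock space up to a constant:
  -- |e(ξ)|²e^{-α|ξ|²} = e^{-α|ξ-z|²}.
  set e : ℂ → ℂ := fun ξ => (twist α z ξ)⁻¹ with he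
  have hne : ∀ ξ, twist α z ξ ≠ 0 := fun ξ => Complex.exp_ne_zero _
  have hed : Differentiable ℂ e := (differentiable_twist α z).inv hne
  have hen : ∀ ξ, ‖e ξ‖ ^ 2 = Real.exp (α * ‖ξ‖ ^ 2 - α * ‖ξ - z‖ ^ 2) := by
    intro ξ
    rw [he, norm_inv, norm_twist, ← Real.exp_neg, ← Real.exp_nat_mul]
    congr 1; push_cast; ring
  have hint : ∫⁻ ξ, ‖e ξ‖ₑ ^ 2 ∂w.gaussMeasure α ≤ ENNReal.ofReal (C * w.sqMass r z) := by
    refine le_trans (le_of_eq ?_) (h z)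
    have := w.setLIntegral_gaussMeasure α (hed.continuous.measurable.enorm.pow_const 2)
      MeasurableSet.univ
    rw [Measure.restrict_univ, Measure.restrict_univ] at this
    rw [this]
    refine lintegral_congr fun ξ => ?_
    rw [enorm_sq_eq_ofReal, hen, ← ENNReal.ofReal_mul (Real.exp_pos _).le, ← Real.exp_add]
    congr 2; ring
  have hmem : MemLp e 2 (w.gaussMeasure α) := by
    refine ⟨hed.continuous.aestronglyMeasurable, ?_⟩
    refine (ENNReal.pow_lt_top_iff (n := 2)).1 ?_ |>.resolve_right two_ne_zero
    have h2 := eLpNorm_nnreal_pow_eq_lintegral (μ := w.gaussMeasure α) (f := e) (p := 2)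
      two_ne_zero
    have h3 : eLpNorm e 2 (w.gaussMeasure α) ^ 2 = ∫⁻ ξ, ‖e ξ‖ₑ ^ 2 ∂w.gaussMeasure α := by
      simpa using h2
    rw [h3]
    exact hint.trans_lt ENNReal.ofReal_lt_top
  set E : FockSpace α w := ⟨e, hed, hmem⟩ with hE
  have hEn : ‖E‖ ^ 2 ≤ C * w.sqMass r z := by
    have := (H.sqMass_pos z).le
    rw [← ENNReal.ofReal_le_ofReal_iff (by positivity), ofReal_norm_sq]
    exact hint
  have h1 := norm_apply_le H hα z E
  have h2 : ‖E z‖ ^ 2 = Real.exp (α * ‖z‖ ^ 2) := by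
    have := hen z
    simpa using this
  have h3 : Real.exp (α * ‖z‖ ^ 2) ≤ ‖kernel α w z‖ ^ 2 * (C * w.sqMass r z) := by
    rw [← h2]
    calc ‖E z‖ ^ 2 ≤ (‖kernel α w z‖ * ‖E‖) ^ 2 := by gcongr
      _ = ‖kernel α w z‖ ^ 2 * ‖E‖ ^ 2 := by ring
      _ ≤ _ := by gcongr
  calc (1 : ℝ) = Real.exp (-α * ‖z‖ ^ 2) * Real.exp (α * ‖z‖ ^ 2) := by
        rw [← Real.exp_add]; simp
    _ ≤ Real.exp (-α * ‖z‖ ^ 2) * (‖kernel α w z‖ ^ 2 * (C * w.sqMass r z)) := by gcongr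
    _ = _ := by ring

theorem norm_kernel_pos (H : w.Regular r p K) (hα : 0 < α) (z : ℂ) : 0 < ‖kernel α w z‖ := by
  obtain ⟨C, -, h⟩ := exists_le_norm_kernel_sq (α := α) H hα
  refine lt_of_le_of_ne (norm_nonneg _) fun h0 => ?_
  have := h z
  rw [← h0] at this
  norm_num at this

end FockSpace

/-! ### Normalized kernels, the Berezin transform and averages -/

section

open FockSpace

variable {α : ℝ} {w : Weight} {r p : ℝ} {K : ℝ≥0∞}

theorem norm_normalizedKernel_apply (z ξ : ℂ) :
    ‖normalizedKernel α w z ξ‖ = ‖kernel α w z‖⁻¹ * ‖kernel α w z ξ‖ := by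
  rw [normalizedKernel, smul_apply, norm_mul, Complex.norm_real, norm_inv, norm_norm]

theorem inner_normalizedKernel (H : w.Regular r p K) (hα : 0 < α) (z : ℂ) (f : FockSpace α w) :
    inner ℂ (normalizedKernel α w z) f = ((‖kernel α w z‖⁻¹ : ℝ) : ℂ) * f z := by
  rw [normalizedKernel, inner_smul_left, inner_kernel H hα, Complex.conj_ofReal]

theorem norm_normalizedKernel (H : w.Regular r p K) (hα : 0 < α) (z : ℂ) :
    ‖normalizedKernel α w z‖ = 1 := by
  rw [normalizedKernel, norm_smul, Complex.norm_real, norm_inv, norm_norm,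
    inv_mul_cancel₀ (norm_kernel_pos H hα z).ne']

/-- Lower bound for the normalized reproducing kernel near the diagonal. -/
theorem exists_le_normalizedKernel (H : w.Regular r p K) (hα : 0 < α) :
    ∃ δ c : ℝ, 0 < δ ∧ δ < 1 ∧ δ ≤ r / 2 ∧ 0 < c ∧ ∀ z ξ : ℂ, ‖ξ - z‖ < δ →
      c ≤ w.sqMass r z * (‖normalizedKernel α w z ξ‖ ^ 2 * Real.exp (-α * ‖ξ‖ ^ 2)) := by
  obtain ⟨C₁, hC₁, h₁⟩ := exists_norm_kernel_sq_le (α := α) H hα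
  obtain ⟨C₂, hC₂, h₂⟩ := exists_le_norm_kernel_sq (α := α) H hα
  obtain ⟨b, hb, hV⟩ := H.exists_sqMass_le_exp
  set s := r / 2 with hs
  have hs0 : 0 < s := half_pos H.pos
  set C₃ := Real.exp (b * (s + 1)) * C₁ * Real.exp (α * s ^ 2) with hC₃
  have hC₃0 : 0 < C₃ := by positivity
  -- q is the ratio M/m of the upper bound M for |g| on the disc of radius s to the lower bound m at
  -- its centre. The radius s/(4q) makes Schwarz's lemma give |g(ξ) - g(z)| ≤ m/2; the entry 1/2
  -- only ensures δ < 1.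
  set q := √(C₃ * C₂) with hq
  have hq0 : 0 < q := by positivity
  refine ⟨min (min (s / (4 * q)) s) (1 / 2), Real.exp (-α * s ^ 2) / (4 * C₂), by positivity,
    (min_le_right _ _).trans_lt (by norm_num), (min_le_left _ _).trans (min_le_right _ _),
    by positivity, fun z ξ hξ => ?_⟩
  have hξ1 : ‖ξ - z‖ < s / (4 * q) :=
    hξ.trans_le ((min_le_left _ _).trans (min_le_left _ _))
  have hξ2 : ‖ξ - z‖ < s := hξ.trans_le ((min_le_left _ _).trans (min_le_right _ _))
  set B := kernel α w z with hB
  have hVz := H.sqMass_pos z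
  have hBpos : 0 < ‖B‖ := norm_kernel_pos H hα z
  set g : ℂ → ℂ := fun ξ => B ξ * twist α z ξ with hg
  have hgd : Differentiable ℂ g := B.differentiable.mul (differentiable_twist α z)
  set N := ‖B‖ ^ 2 / w.sqMass r z with hN
  have hN0 : 0 < N := by positivity
  have hup : ∀ η, ‖η - z‖ < s → ‖g η‖ ^ 2 ≤ C₃ * N := by
    intro η hη
    have hVη := H.sqMass_pos η
    have hVV : w.sqMass r z ≤ Real.exp (b * (s + 1)) * w.sqMass r η := by
      refine (hV z η).trans (mul_le_mul_of_nonneg_right (Real.exp_le_exp.2 ?_) hVη.le)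
      rw [norm_sub_rev]
      gcongr
    have e1 : ‖B η‖ ≤ ‖kernel α w η‖ * ‖B‖ := norm_apply_le H hα η B
    have e2 := h₁ η
    rw [hg, norm_mul_twist_sq, hN, mul_div_assoc', le_div_iff₀ hVz]
    calc ‖B η‖ ^ 2 * Real.exp (-α * ‖η‖ ^ 2) * Real.exp (α * ‖η - z‖ ^ 2) * w.sqMass r z
        ≤ (‖kernel α w η‖ * ‖B‖) ^ 2 * Real.exp (-α * ‖η‖ ^ 2) * Real.exp (α * s ^ 2) *
          (Real.exp (b * (s + 1)) * w.sqMass r η) := by gcongr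
      _ = (‖kernel α w η‖ ^ 2 * Real.exp (-α * ‖η‖ ^ 2) * w.sqMass r η) *
          (Real.exp (b * (s + 1)) * Real.exp (α * s ^ 2) * ‖B‖ ^ 2) := by ring
      _ ≤ C₁ * (Real.exp (b * (s + 1)) * Real.exp (α * s ^ 2) * ‖B‖ ^ 2) := by gcongr
      _ = C₃ * ‖B‖ ^ 2 := by rw [hC₃]; ring
  have hlo : N / C₂ ≤ ‖g z‖ ^ 2 := by
    rw [hg, norm_mul_twist_sq, sub_self, norm_zero, hB, kernel_apply_self H hα, Complex.norm_real,
      Real.norm_of_nonneg (by positivity), hN, div_div, div_le_iff₀ (by positivity), ← hB]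
    have := h₂ z
    rw [← hB] at this
    calc ‖B‖ ^ 2 = ‖B‖ ^ 2 * 1 := by ring
      _ ≤ ‖B‖ ^ 2 * (C₂ * (‖B‖ ^ 2 * Real.exp (-α * ‖z‖ ^ 2) * w.sqMass r z)) := by gcongr
      _ = _ := by norm_num; ring
  set M := √(C₃ * N) with hM
  set m := √(N / C₂) with hm
  have hMm : M = q * m := by
    rw [hM, hq, hm, ← Real.sqrt_mul (by positivity)]
    congr 1
    field_simp
  have hup' : ∀ η ∈ Metric.ball z s, ‖g η‖ ≤ M := fun η hη =>
    Real.le_sqrt_of_sq_le (hup η (by rwa [Metric.mem_ball, Complex.dist_eq] at hη))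
  have hlo' : m ≤ ‖g z‖ := Real.sqrt_le_iff.2 ⟨norm_nonneg _, hlo⟩
  have hmaps : Set.MapsTo g (Metric.ball z s) (Metric.closedBall (g z) (2 * M)) := by
    intro η hη
    rw [Metric.mem_closedBall, dist_eq_norm]
    have := norm_sub_le (g η) (g z)
    linarith [hup' η hη, hup' z (Metric.mem_ball_self hs0)]
  have hξb : ξ ∈ Metric.ball z s := by rwa [Metric.mem_ball, Complex.dist_eq]
  have hsch := Complex.dist_le_div_mul_dist_of_mapsTo_ball hgd.differentiableOn hmaps hξb
  rw [dist_eq_norm, Complex.dist_eq] at hsch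
  have hm0 : 0 < m := by positivity
  have hdiff : ‖g ξ - g z‖ ≤ m / 2 := by
    refine hsch.trans ?_
    calc 2 * M / s * ‖ξ - z‖ ≤ 2 * M / s * (s / (4 * q)) := by gcongr
      _ = m / 2 := by rw [hMm]; field_simp; norm_num
  have hgξ : m / 2 ≤ ‖g ξ‖ := by
    have := norm_sub_norm_le (g z) (g z - g ξ)
    rw [sub_sub_cancel, norm_sub_rev (g z) (g ξ)] at this
    linarith
  have hgξ2 : N / (4 * C₂) ≤ ‖g ξ‖ ^ 2 := by
    have e1 : (m / 2) ^ 2 = N / (4 * C₂) := by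
      rw [div_pow, hm, Real.sq_sqrt (by positivity)]
      field_simp
      norm_num
    rw [← e1]
    gcongr
  rw [hg, norm_mul_twist_sq] at hgξ2
  rw [norm_normalizedKernel_apply, ← hB]
  have hE : Real.exp (α * ‖ξ - z‖ ^ 2) ≤ Real.exp (α * s ^ 2) := by gcongr
  have h5 : N / (4 * C₂) ≤ ‖B ξ‖ ^ 2 * Real.exp (-α * ‖ξ‖ ^ 2) * Real.exp (α * s ^ 2) :=
    hgξ2.trans (by gcongr)
  have h6 : N / (4 * C₂) * Real.exp (-α * s ^ 2) ≤ ‖B ξ‖ ^ 2 * Real.exp (-α * ‖ξ‖ ^ 2) := by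
    rw [neg_mul, Real.exp_neg, ← div_eq_mul_inv, div_le_iff₀ (Real.exp_pos _)]
    simpa using h5
  calc Real.exp (-α * s ^ 2) / (4 * C₂)
      = w.sqMass r z * (‖B‖⁻¹ ^ 2 * (N / (4 * C₂) * Real.exp (-α * s ^ 2))) := by
        rw [hN]; field_simp
    _ ≤ w.sqMass r z * (‖B‖⁻¹ ^ 2 * (‖B ξ‖ ^ 2 * Real.exp (-α * ‖ξ‖ ^ 2))) := by gcongr
    _ = _ := by ring

theorem kernel_apply_swap (H : w.Regular r p K) (hα : 0 < α) (z ξ : ℂ) :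
    kernel α w z ξ = conj (kernel α w ξ z) := by
  rw [← inner_kernel H hα ξ, ← inner_kernel H hα z, inner_conj_symm]

/-- By symmetry, otherwise B_ξ would vanish outside a disc, hence identically, against B_ξ(ξ) =
‖B_ξ‖² > 0. -/
theorem exists_kernel_apply_ne_zero (H : w.Regular r p K) (hα : 0 < α) (ξ : ℂ) (R : ℝ) :
    ∃ z : ℂ, R ≤ ‖z‖ ∧ kernel α w z ξ ≠ 0 := by
  by_contra! hcon
  have hz : ∀ z : ℂ, R ≤ ‖z‖ → kernel α w ξ z = 0 := by
    intro z hz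
    rw [kernel_apply_swap H hα, hcon z hz, map_zero]
  have han : AnalyticOnNhd ℂ (kernel α w ξ).1 Set.univ := fun z _ =>
    (kernel α w ξ).differentiable.analyticAt z
  have h0 : (kernel α w ξ).1 = 0 := by
    refine han.eq_of_eventuallyEq (z₀ := ((|R| + 1 : ℝ) : ℂ)) (fun z _ => analyticAt_const) ?_
    have hnhds : {z : ℂ | R < ‖z‖} ∈ 𝓝 ((|R| + 1 : ℝ) : ℂ) := by
      refine (isOpen_lt continuous_const continuous_norm).mem_nhds ?_
      change R < ‖((|R| + 1 : ℝ) : ℂ)‖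
      rw [Complex.norm_real, Real.norm_of_nonneg (by positivity)]
      linarith [le_abs_self R]
    filter_upwards [hnhds] with z hz'
    exact hz z (le_of_lt hz')
  have h1 := kernel_apply_self H hα ξ
  have h2 : kernel α w ξ ξ = 0 := congrFun h0 ξ
  rw [h2] at h1
  have := norm_kernel_pos (α := α) H hα ξ
  have h3 : ‖kernel α w ξ‖ ^ 2 = 0 := by exact_mod_cast h1.symm
  exact this.ne' (pow_eq_zero_iff two_ne_zero |>.1 h3)

/-- The Berezin transform is known to be finite only for |z| large. For each ξ some such z has
B_z(ξ) ≠ 0, so its integrand is bounded below near ξ, and Markov's inequality bounds μ there. -/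
theorem isLocallyFiniteMeasure_of_tendsto_berezin (H : w.Regular r p K) (hα : 0 < α)
    {μ : Measure ℂ} (h : Tendsto (berezin α w μ) (Bornology.cobounded ℂ) (𝓝 0)) :
    IsLocallyFiniteMeasure μ := by
  have hev : ∀ᶠ z in Bornology.cobounded ℂ, berezin α w μ z < 1 :=
    h.eventually (gt_mem_nhds zero_lt_one)
  obtain ⟨R, -, hR⟩ := (hasBasis_cobounded_norm.eventually_iff).1 hev
  refine ⟨fun ξ => ?_⟩
  obtain ⟨z, hz, hne⟩ := exists_kernel_apply_ne_zero (α := α) H hα ξ R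
  have hfin : berezin α w μ z < ⊤ := (hR hz).trans ENNReal.one_lt_top
  have hcont : Continuous fun η => ‖normalizedKernel α w z η‖ ^ 2 * Real.exp (-α * ‖η‖ ^ 2) := by
    have := (normalizedKernel α w z).continuous
    fun_prop
  have hpos : 0 < ‖normalizedKernel α w z ξ‖ ^ 2 * Real.exp (-α * ‖ξ‖ ^ 2) := by
    rw [norm_normalizedKernel_apply]
    have := norm_kernel_pos (α := α) H hα z
    have := norm_pos_iff.2 hne
    positivity
  obtain ⟨ε, hε, hlt⟩ := exists_between hpos
  refine ⟨_, (isOpen_lt continuous_const hcont).mem_nhds hlt, ?_⟩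
  have hm := mul_meas_ge_le_lintegral₀ (μ := μ)
    hcont.measurable.ennreal_ofReal.aemeasurable (ENNReal.ofReal ε)
  have hfin2 := hm.trans_lt hfin
  have h3 : μ {η | ENNReal.ofReal ε ≤ ENNReal.ofReal
      (‖normalizedKernel α w z η‖ ^ 2 * Real.exp (-α * ‖η‖ ^ 2))} < ⊤ := by
    rcases ENNReal.mul_lt_top_iff.1 hfin2 with h | h | h
    · exact h.2
    · exact absurd h (ENNReal.ofReal_pos.2 hε).ne'
    · rw [h]; exact ENNReal.zero_lt_top
  refine (measure_mono fun η hη => ?_).trans_lt h3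
  exact ENNReal.ofReal_le_ofReal (le_of_lt hη)

/-- For all small `s`, the averages over discs of radius `s` are controlled by the Berezin
transform. -/
theorem averageVanishes_of_tendsto_berezin (H : w.Regular r p K) (hα : 0 < α) {δ c : ℝ}
    (hδr : δ ≤ r / 2) (hc : 0 < c)
    (hlow : ∀ z ξ : ℂ, ‖ξ - z‖ < δ →
      c ≤ w.sqMass r z * (‖normalizedKernel α w z ξ‖ ^ 2 * Real.exp (-α * ‖ξ‖ ^ 2)))
    {μ : Measure ℂ} (h : Tendsto (berezin α w μ) (Bornology.cobounded ℂ) (𝓝 0))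
    {s : ℝ} (hs : 0 < s) (hsδ : s < δ) : AverageVanishes w μ s := by
  have hfin := isLocallyFiniteMeasure_of_tendsto_berezin H hα h
  obtain ⟨C, hC, hCV⟩ := H.exists_sqMass_le_measure_ball hs (hsδ.le.trans hδr)
  have hbm : ∀ z : ℂ, MeasurableSet (Metric.ball z s) := fun z => Metric.isOpen_ball.measurableSet
  have hW0 : ∀ z, w.measure (Metric.ball z s) ≠ 0 := by
    intro z h0
    have := hCV z
    rw [h0, mul_zero, nonpos_iff_eq_zero, ENNReal.ofReal_eq_zero] at this
    exact (H.sqMass_pos z).not_ge this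
  have hWt : ∀ z, w.measure (Metric.ball z s) ≠ ⊤ := fun z => measure_ball_lt_top.ne
  refine ⟨fun z => ?_, ?_⟩
  · rw [average, Weight.mass_eq_measure _ (hbm z)]
    exact ENNReal.div_lt_top measure_ball_lt_top.ne (hW0 z)
  have hle : ∀ z, average w μ s z ≤ ENNReal.ofReal (C / c) * berezin α w μ z := by
    intro z
    rw [average, Weight.mass_eq_measure _ (hbm z)]
    refine ENNReal.div_le_of_le_mul ?_
    have h1 : ENNReal.ofReal c * μ (Metric.ball z s) ≤
        ENNReal.ofReal (w.sqMass r z) * berezin α w μ z := by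
      rw [berezin, ← lintegral_const_mul' _ _ ENNReal.ofReal_ne_top, ← setLIntegral_const]
      refine le_trans (setLIntegral_mono' (hbm z) fun ξ hξ => ?_) (setLIntegral_le_lintegral _ _)
      rw [← ENNReal.ofReal_mul (H.sqMass_pos z).le]
      refine ENNReal.ofReal_le_ofReal (hlow z ξ ?_)
      rw [Metric.mem_ball, Complex.dist_eq] at hξ
      exact hξ.trans hsδ
    have hc0 : ENNReal.ofReal c ≠ 0 := (ENNReal.ofReal_pos.2 hc).ne'
    have h2 : μ (Metric.ball z s) ≤
        (ENNReal.ofReal (w.sqMass r z) * berezin α w μ z) / ENNReal.ofReal c :=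
      (ENNReal.le_div_iff_mul_le (Or.inl hc0) (Or.inl ENNReal.ofReal_ne_top)).2
        ((mul_comm _ _).trans_le h1)
    refine h2.trans ?_
    rw [ENNReal.ofReal_div_of_pos hc]
    calc ENNReal.ofReal (w.sqMass r z) * berezin α w μ z / ENNReal.ofReal c
        ≤ (ENNReal.ofReal C * w.measure (Metric.ball z s)) * berezin α w μ z /
          ENNReal.ofReal c := by gcongr; exact hCV z
      _ = _ := by simp only [div_eq_mul_inv]; ring
  have hlim : Tendsto (fun z => ENNReal.ofReal (C / c) * berezin α w μ z)
      (Bornology.cobounded ℂ) (𝓝 0) := by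
    have := ENNReal.Tendsto.const_mul (a := ENNReal.ofReal (C / c)) h
      (Or.inr ENNReal.ofReal_ne_top)
    rwa [mul_zero] at this
  exact tendsto_of_tendsto_of_tendsto_of_le_of_le tendsto_const_nhds hlim
    (fun _ => zero_le) hle

/-! ### Compactness forces the Berezin transform to vanish at infinity -/

/-- The energy of `f` far away from the origin is small. -/
theorem exists_setLIntegral_lt (f : FockSpace α w) {ε : ℝ≥0∞} (hε : 0 < ε) :
    ∃ R : ℝ, ∫⁻ ξ in {ξ : ℂ | R ≤ ‖ξ‖}, ‖f ξ‖ₑ ^ 2 ∂w.gaussMeasure α < ε := by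
  have hms : ∀ n : ℕ, MeasurableSet {ξ : ℂ | (n : ℝ) ≤ ‖ξ‖} := fun n =>
    (isClosed_le continuous_const continuous_norm).measurableSet
  have hfin : ∫⁻ ξ, ‖f ξ‖ₑ ^ 2 ∂w.gaussMeasure α ≠ ⊤ := by
    rw [← ofReal_norm_sq]
    exact ENNReal.ofReal_ne_top
  set ρ := (w.gaussMeasure α).withDensity fun ξ => ‖f ξ‖ₑ ^ 2 with hρ
  have : IsFiniteMeasure ρ := isFiniteMeasure_withDensity hfin
  have hlim : Tendsto (fun n : ℕ => ρ {ξ : ℂ | (n : ℝ) ≤ ‖ξ‖}) atTop (𝓝 0) := by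
    have hinter : (⋂ n : ℕ, {ξ : ℂ | (n : ℝ) ≤ ‖ξ‖}) = ∅ := by
      ext ξ
      simp only [Set.mem_iInter, Set.mem_ofPred_eq, Set.mem_empty_iff_false, iff_false, not_forall,
        not_le]
      exact exists_nat_gt _
    rw [← measure_empty (μ := ρ), ← hinter]
    refine tendsto_measure_iInter_atTop (fun n => (hms n).nullMeasurableSet) ?_
      ⟨0, measure_ne_top _ _⟩
    intro m n hmn ξ hξ
    have hξ' : (n : ℝ) ≤ ‖ξ‖ := hξ
    exact (Nat.cast_le.2 hmn).trans hξ'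
  obtain ⟨n, hn⟩ := (hlim.eventually (gt_mem_nhds hε)).exists
  exact ⟨n, by rwa [hρ, withDensity_apply _ (hms n)] at hn⟩

/-- The normalized kernels tend weakly to zero. -/
theorem tendsto_inner_normalizedKernel (H : w.Regular r p K) (hα : 0 < α) (f : FockSpace α w) :
    Tendsto (fun z => inner ℂ (normalizedKernel α w z) f) (Bornology.cobounded ℂ) (𝓝 0) := by
  set s := r / 2 with hs
  have hs0 : 0 < s := half_pos H.pos
  obtain ⟨C, hC, hpt⟩ := H.exists_pointwise_le hα hs0 le_rfl
  obtain ⟨C₂, hC₂, h₂⟩ := exists_le_norm_kernel_sq (α := α) H hα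
  rw [tendsto_zero_iff_norm_tendsto_zero, Metric.tendsto_nhds]
  intro ε hε
  set η := ε ^ 2 / (C₂ * C) with hη
  have hη0 : 0 < η := by positivity
  -- The pointwise estimate at z sees only the energy of f on the disc of radius s, which lies in
  -- |ξ| ≥ R once |z| ≥ R + s. The factor C₂ * C in η comes from this estimate and the lower bound
  -- for ‖B_z‖.
  obtain ⟨R, hR⟩ := exists_setLIntegral_lt f (ENNReal.ofReal_pos.2 hη0)
  refine hasBasis_cobounded_norm.eventually_iff.2 ⟨R + s, trivial, fun z hz => ?_⟩
  have hz : R + s ≤ ‖z‖ := hz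
  rw [dist_zero_right, norm_norm, inner_normalizedKernel H hα, norm_mul, Complex.norm_real,
    norm_inv, norm_norm]
  have hB := norm_kernel_pos (α := α) H hα z
  have hVz := H.sqMass_pos z
  have h1 : ENNReal.ofReal (w.sqMass r z * (‖f z‖ ^ 2 * Real.exp (-α * ‖z‖ ^ 2))) <
      ENNReal.ofReal (C * η) := by
    refine (hpt f f.differentiable z).trans_lt ?_
    rw [ENNReal.ofReal_mul hC.le]
    refine ENNReal.mul_lt_mul_right (ENNReal.ofReal_pos.2 hC).ne' ENNReal.ofReal_ne_top
      (lt_of_le_of_lt (lintegral_mono_set fun ξ hξ => ?_) hR)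
    rw [Metric.mem_ball, Complex.dist_eq] at hξ
    have := norm_add_le ξ (z - ξ)
    rw [add_sub_cancel, norm_sub_rev z ξ] at this
    change R ≤ ‖ξ‖
    linarith
  rw [ENNReal.ofReal_lt_ofReal_iff (by positivity)] at h1
  have h3 : (‖kernel α w z‖⁻¹ * ‖f z‖) ^ 2 < ε ^ 2 := by
    rw [mul_pow, inv_pow, inv_mul_lt_iff₀ (by positivity)]
    calc ‖f z‖ ^ 2 = ‖f z‖ ^ 2 * 1 := by ring
      _ ≤ ‖f z‖ ^ 2 * (C₂ * (‖kernel α w z‖ ^ 2 * Real.exp (-α * ‖z‖ ^ 2) * w.sqMass r z)) := by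
          gcongr; exact h₂ z
      _ = (w.sqMass r z * (‖f z‖ ^ 2 * Real.exp (-α * ‖z‖ ^ 2))) * (C₂ * ‖kernel α w z‖ ^ 2) := by
          ring
      _ < (C * η) * (C₂ * ‖kernel α w z‖ ^ 2) := by gcongr
      _ = ‖kernel α w z‖ ^ 2 * ε ^ 2 := by rw [hη]; field_simp
  exact lt_of_pow_lt_pow_left₀ 2 hε.le h3

/-- The integrand of T b_z(z) is ‖B_z‖ |b_z|²e^{-α|·|²}, and pairing with b_z divides by ‖B_z‖. The
absolute convergence in `IsToeplitz` makes the transform finite. -/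
theorem berezin_eq_norm_inner (H : w.Regular r p K) (hα : 0 < α) {μ : Measure ℂ}
    {T : FockSpace α w →L[ℂ] FockSpace α w} (hT : IsToeplitz μ T) (z : ℂ) :
    berezin α w μ z =
      ENNReal.ofReal ‖inner ℂ (normalizedKernel α w z) (T (normalizedKernel α w z))‖ := by
  obtain ⟨h1, h2⟩ := hT (normalizedKernel α w z) z
  have hB := norm_kernel_pos (α := α) H hα z
  set B := kernel α w z with hBdef
  set h : ℂ → ℝ := fun ξ => ‖normalizedKernel α w z ξ‖ ^ 2 * Real.exp (-α * ‖ξ‖ ^ 2) with hh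
  have he : toeplitzIntegrand (normalizedKernel α w z) z = fun ξ => ((‖B‖ * h ξ : ℝ) : ℂ) := by
    ext ξ
    have hBξ : B ξ = (‖B‖ : ℂ) * normalizedKernel α w z ξ := by
      rw [normalizedKernel, smul_apply, ← hBdef, ← mul_assoc, ← Complex.ofReal_mul,
        mul_inv_cancel₀ hB.ne', Complex.ofReal_one, one_mul]
    rw [toeplitzIntegrand, ← hBdef, hBξ, map_mul, Complex.conj_ofReal, hh]
    push_cast
    rw [← Complex.conj_mul' (normalizedKernel α w z ξ)]
    ring
  rw [he] at h1 h2
  have hint : Integrable h μ := by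
    have h3 : Integrable (fun ξ => ‖B‖ * h ξ) μ := by
      have := h1.re
      simpa only [RCLike.re_eq_complex_re, Complex.ofReal_re] using this
    have := h3.const_mul ‖B‖⁻¹
    refine this.congr (Eventually.of_forall fun ξ => ?_)
    change ‖B‖⁻¹ * (‖B‖ * h ξ) = h ξ
    rw [inv_mul_cancel_left₀ hB.ne']
  have hnn : ∀ ξ, 0 ≤ h ξ := fun ξ => by positivity
  rw [integral_complex_ofReal, integral_const_mul] at h2
  rw [inner_normalizedKernel H hα, h2, ← hBdef, ← Complex.ofReal_mul,
    inv_mul_cancel_left₀ hB.ne', Complex.norm_real, Real.norm_of_nonneg (integral_nonneg hnn),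
    ofReal_integral_eq_lintegral_ofReal hint (Eventually.of_forall hnn)]
  rfl

theorem tendsto_berezin_of_toeplitzCompact (H : w.Regular r p K) (hα : 0 < α) {μ : Measure ℂ}
    (h : ToeplitzCompact α w μ) : Tendsto (berezin α w μ) (Bornology.cobounded ℂ) (𝓝 0) := by
  obtain ⟨T, hT, hc⟩ := h
  suffices hs : Tendsto (fun z => ‖inner ℂ (normalizedKernel α w z) (T (normalizedKernel α w z))‖)
      (Bornology.cobounded ℂ) (𝓝 0) by
    have := ENNReal.tendsto_ofReal hs
    rw [ENNReal.ofReal_zero] at this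
    exact this.congr fun z => (berezin_eq_norm_inner H hα hT z).symm
  obtain ⟨S, hS, hsub⟩ := IsCompactOperator.image_closedBall_subset_compact
    (show IsCompactOperator T.toLinearMap from hc) 1
  rw [Metric.tendsto_nhds]
  intro ε hε
  -- Weak convergence b_z → 0 is used only against the finitely many centres of an ε/2-net of a
  -- compact set containing all T b_z.
  obtain ⟨t, -, ht, hcov⟩ := hS.finite_cover_balls (half_pos hε)
  have hev : ∀ᶠ z in Bornology.cobounded ℂ, ∀ y ∈ t,
      ‖inner ℂ (normalizedKernel α w z) y‖ < ε / 2 := by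
    refine (ht.eventually_all).2 fun y _ => ?_
    have := (tendsto_inner_normalizedKernel H hα y).norm
    rw [norm_zero] at this
    exact this.eventually (gt_mem_nhds (half_pos hε))
  filter_upwards [hev] with z hz
  rw [dist_zero_right, norm_norm]
  set b := normalizedKernel α w z
  have hb : ‖b‖ = 1 := norm_normalizedKernel H hα z
  have hmem : T b ∈ S := hsub ⟨b, by simp [hb], rfl⟩
  obtain ⟨y, hy, hyb⟩ := Set.mem_iUnion₂.1 (hcov hmem)
  rw [Metric.mem_ball, dist_eq_norm] at hyb
  have e : inner ℂ b (T b) = inner ℂ b y + inner ℂ b (T b - y) := by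
    rw [inner_sub_right]; ring
  rw [e]
  have h1 := norm_inner_le_norm (𝕜 := ℂ) b (T b - y)
  rw [hb, one_mul] at h1
  linarith [norm_add_le (inner ℂ b y) (inner ℂ b (T b - y)), hz y hy]


/-! ### Carleson estimates for the measure e^{-α|ξ|²} dμ -/

instance (w : Weight) (α : ℝ) : SFinite (w.gaussMeasure α) :=
  inferInstanceAs (SFinite (volume.withDensity _))

/-- The measure `e^{-α|ξ|²} dμ`. -/
def gaussDensity (α : ℝ) (μ : Measure ℂ) : Measure ℂ :=
  μ.withDensity fun ξ => ENNReal.ofReal (Real.exp (-α * ‖ξ‖ ^ 2))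

theorem measurable_ofReal_exp (α : ℝ) :
    Measurable fun ξ : ℂ => ENNReal.ofReal (Real.exp (-α * ‖ξ‖ ^ 2)) := by
  have h1 : Continuous fun z : ℂ => Real.exp (-α * ‖z‖ ^ 2) := by fun_prop
  exact h1.measurable.ennreal_ofReal

theorem setLIntegral_gaussDensity (α : ℝ) (μ : Measure ℂ) {F : ℂ → ℝ≥0∞} (hF : Measurable F)
    {S : Set ℂ} (hS : MeasurableSet S) :
    ∫⁻ z in S, F z ∂gaussDensity α μ =
      ∫⁻ z in S, ENNReal.ofReal (Real.exp (-α * ‖z‖ ^ 2)) * F z ∂μ := by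
  rw [gaussDensity, setLIntegral_withDensity_eq_setLIntegral_mul _ (measurable_ofReal_exp α) hF hS]
  rfl

theorem gaussDensity_ball_le (hα : 0 < α) (μ : Measure ℂ) (R : ℝ) :
    gaussDensity α μ (Metric.ball 0 R) ≤ μ (Metric.ball 0 R) := by
  rw [gaussDensity, withDensity_apply _ Metric.isOpen_ball.measurableSet, ← setLIntegral_one]
  refine lintegral_mono fun ξ => ?_
  rw [← ENNReal.ofReal_one]
  refine ENNReal.ofReal_le_ofReal (Real.exp_le_one_iff.2 ?_)
  rw [neg_mul]
  exact neg_nonpos.2 (by positivity)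

/-- Discs have finite `w`-mass, so a finite quotient forces a finite numerator. The resulting
σ-finiteness of μ is what Tonelli's theorem needs. -/
theorem AverageVanishes.isLocallyFiniteMeasure {μ : Measure ℂ} {s : ℝ} (hs : 0 < s)
    (h : AverageVanishes w μ s) : IsLocallyFiniteMeasure μ := by
  refine ⟨fun z => ⟨Metric.ball z s, Metric.ball_mem_nhds z hs, ?_⟩⟩
  have h1 := h.1 z
  rw [average, Weight.mass_eq_measure _ Metric.isOpen_ball.measurableSet] at h1
  by_contra h2
  rw [not_lt, top_le_iff] at h2
  rw [h2, ENNReal.top_div_of_ne_top measure_ball_lt_top.ne] at h1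
  exact lt_irrefl _ h1

/-- A Carleson type inequality. -/
theorem exists_setLIntegral_gaussDensity_le (H : w.Regular r p K) (hα : 0 < α) {s : ℝ}
    (hs : 0 < s) (hsr : s ≤ r / 2) :
    ∃ C : ℝ, 0 < C ∧ ∀ (μ : Measure ℂ) [SFinite μ] (S : Set ℂ), MeasurableSet S →
      ∀ f : FockSpace α w, ∫⁻ ξ in S, ‖f ξ‖ₑ ^ 2 ∂gaussDensity α μ ≤
        ENNReal.ofReal C * ∫⁻ u, ‖f u‖ₑ ^ 2 * (μ (Metric.ball u s ∩ S) /
          ENNReal.ofReal (w.sqMass r u)) ∂w.gaussMeasure α := by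
  obtain ⟨C, hC, hpt⟩ := H.exists_pointwise_le hα hs hsr
  obtain ⟨b, hb, hV⟩ := H.exists_sqMass_le_exp
  set D := Real.exp (b * (s + 1)) with hD
  have hD0 : 0 < D := Real.exp_pos _
  refine ⟨D * C, by positivity, fun μ _ S hS f => ?_⟩
  have hfm : Measurable fun ξ => ‖f ξ‖ₑ ^ 2 := f.continuous.measurable.enorm.pow_const 2
  have hVm : Measurable fun u => ENNReal.ofReal (w.sqMass r u) :=
    (w.measurable_sqMass r).ennreal_ofReal
  set E : ℂ → ℝ≥0∞ := fun u => ‖f u‖ₑ ^ 2 / ENNReal.ofReal (w.sqMass r u) with hE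
  have hEm : Measurable E := hfm.div hVm
  have hQ : MeasurableSet {q : ℂ × ℂ | dist q.2 q.1 < s} :=
    (isOpen_lt (by fun_prop) continuous_const).measurableSet
  set F : ℂ → ℂ → ℝ≥0∞ := fun ξ u => {q : ℂ × ℂ | dist q.2 q.1 < s}.indicator
    (fun q => E q.2) (ξ, u) with hF
  have hFm : Measurable (Function.uncurry F) := (hEm.comp measurable_snd).indicator hQ
  have hF1 : ∀ ξ, F ξ = (Metric.ball ξ s).indicator E := fun ξ => rfl
  have hF2 : ∀ u, (fun ξ => F ξ u) = (Metric.ball u s).indicator fun _ => E u := by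
    intro u
    ext ξ
    simp only [hF, Set.indicator, Set.mem_ofPred_eq, Metric.mem_ball, dist_comm ξ u]
  have hbm : ∀ u : ℂ, MeasurableSet (Metric.ball u s) := fun u => Metric.isOpen_ball.measurableSet
  -- The pointwise estimate divided by `sqMass` at ξ; moving this division from ξ to u, inside the
  -- integral, costs the factor D.
  have hpoint : ∀ ξ, ENNReal.ofReal (Real.exp (-α * ‖ξ‖ ^ 2)) * ‖f ξ‖ₑ ^ 2 ≤
      ENNReal.ofReal (D * C) * ∫⁻ u, F ξ u ∂w.gaussMeasure α := by
    intro ξ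
    have h0 : ENNReal.ofReal (w.sqMass r ξ) ≠ 0 := (ENNReal.ofReal_pos.2 (H.sqMass_pos ξ)).ne'
    have h1 := hpt f f.differentiable ξ
    rw [ENNReal.ofReal_mul (H.sqMass_pos ξ).le, mul_comm (‖f ξ‖ ^ 2),
      ENNReal.ofReal_mul (Real.exp_pos _).le, ← enorm_sq_eq_ofReal] at h1
    rw [← ENNReal.mul_le_mul_iff_right h0 ENNReal.ofReal_ne_top]
    refine h1.trans ?_
    rw [hF1, lintegral_indicator (hbm ξ), ← mul_assoc, ← lintegral_const_mul' _ _
      ENNReal.ofReal_ne_top, ← lintegral_const_mul' _ _ (ENNReal.mul_ne_top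
      ENNReal.ofReal_ne_top ENNReal.ofReal_ne_top)]
    refine setLIntegral_mono' (hbm ξ) fun u hu => ?_
    have hVu := H.sqMass_pos u
    have hle : w.sqMass r u ≤ D * w.sqMass r ξ := by
      refine (hV u ξ).trans (mul_le_mul_of_nonneg_right (Real.exp_le_exp.2 ?_)
        (H.sqMass_pos ξ).le)
      rw [Metric.mem_ball, Complex.dist_eq] at hu
      gcongr
    rw [hE]
    have hu0 : ENNReal.ofReal (w.sqMass r u) ≠ 0 := (ENNReal.ofReal_pos.2 hVu).ne'
    calc ENNReal.ofReal C * ‖f u‖ₑ ^ 2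
        = ENNReal.ofReal C * (ENNReal.ofReal (w.sqMass r u) *
          (‖f u‖ₑ ^ 2 / ENNReal.ofReal (w.sqMass r u))) := by
          rw [ENNReal.mul_div_cancel hu0 ENNReal.ofReal_ne_top]
      _ ≤ ENNReal.ofReal C * (ENNReal.ofReal (D * w.sqMass r ξ) *
          (‖f u‖ₑ ^ 2 / ENNReal.ofReal (w.sqMass r u))) := by gcongr
      _ = _ := by
          rw [ENNReal.ofReal_mul hD0.le, ENNReal.ofReal_mul hD0.le]
          ring
  rw [setLIntegral_gaussDensity α μ hfm hS]
  calc ∫⁻ ξ in S, ENNReal.ofReal (Real.exp (-α * ‖ξ‖ ^ 2)) * ‖f ξ‖ₑ ^ 2 ∂μ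
      ≤ ∫⁻ ξ in S, ENNReal.ofReal (D * C) * ∫⁻ u, F ξ u ∂w.gaussMeasure α ∂μ :=
        lintegral_mono hpoint
    _ = ENNReal.ofReal (D * C) * ∫⁻ ξ in S, ∫⁻ u, F ξ u ∂w.gaussMeasure α ∂μ :=
        lintegral_const_mul' _ _ ENNReal.ofReal_ne_top
    _ = ENNReal.ofReal (D * C) * ∫⁻ u, (∫⁻ ξ in S, F ξ u ∂μ) ∂w.gaussMeasure α := by
        rw [lintegral_lintegral_swap hFm.aemeasurable]
    _ = _ := by
        congr 1
        refine lintegral_congr fun u => ?_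
        rw [hF2, lintegral_indicator (hbm u), setLIntegral_const, Measure.restrict_apply (hbm u),
          hE]
        simp only [div_eq_mul_inv]
        ring

theorem AverageVanishes.exists_setLIntegral_le (H : w.Regular r p K) (hα : 0 < α) {s : ℝ}
    (hs : 0 < s) (hsr : s ≤ r / 2) {μ : Measure ℂ} (h : AverageVanishes w μ s) {ε : ℝ}
    (hε : 0 < ε) :
    ∃ R : ℝ, ∀ f : FockSpace α w, ∫⁻ ξ in {ξ : ℂ | R ≤ ‖ξ‖}, ‖f ξ‖ₑ ^ 2 ∂gaussDensity α μ ≤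
      ENNReal.ofReal (ε * ‖f‖ ^ 2) := by
  have := h.isLocallyFiniteMeasure hs
  obtain ⟨C, hC, hcar⟩ := exists_setLIntegral_gaussDensity_le (α := α) H hα hs hsr
  have hη : 0 < ENNReal.ofReal (ε / C) := ENNReal.ofReal_pos.2 (by positivity)
  obtain ⟨R, -, hR⟩ := hasBasis_cobounded_norm.eventually_iff.1
    (h.2.eventually (gt_mem_nhds hη))
  -- Discs of radius s about points with |u| < R miss |ξ| ≥ R + s, so only centres with small
  -- average contribute.
  refine ⟨R + s, fun f => ?_⟩
  have hSm : MeasurableSet {ξ : ℂ | R + s ≤ ‖ξ‖} :=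
    (isClosed_le continuous_const continuous_norm).measurableSet
  have hle : ∀ u, μ (Metric.ball u s ∩ {ξ : ℂ | R + s ≤ ‖ξ‖}) /
      ENNReal.ofReal (w.sqMass r u) ≤ ENNReal.ofReal (ε / C) := by
    intro u
    rcases lt_or_ge ‖u‖ R with hu | hu
    · have hemp : Metric.ball u s ∩ {ξ : ℂ | R + s ≤ ‖ξ‖} = ∅ := by
        ext ξ
        simp only [Set.mem_inter_iff, Metric.mem_ball, Complex.dist_eq, Set.mem_ofPred_eq,
          Set.mem_empty_iff_false, iff_false, not_and, not_le]
        intro hξ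
        have := norm_add_le u (ξ - u)
        rw [add_sub_cancel] at this
        linarith
      rw [hemp, measure_empty, ENNReal.zero_div]
      exact zero_le
    · refine le_trans ?_ (le_of_lt (hR hu))
      rw [average, Weight.mass_eq_measure _ Metric.isOpen_ball.measurableSet]
      exact ENNReal.div_le_div (measure_mono Set.inter_subset_left)
        (w.measure_ball_le_sqMass hsr u)
  refine (hcar μ _ hSm f).trans ?_
  calc ENNReal.ofReal C * ∫⁻ u, ‖f u‖ₑ ^ 2 * (μ (Metric.ball u s ∩ {ξ : ℂ | R + s ≤ ‖ξ‖}) /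
        ENNReal.ofReal (w.sqMass r u)) ∂w.gaussMeasure α
      ≤ ENNReal.ofReal C * ∫⁻ u, ‖f u‖ₑ ^ 2 * ENNReal.ofReal (ε / C) ∂w.gaussMeasure α := by
        gcongr with u
        exact hle u
    _ = ENNReal.ofReal (ε * ‖f‖ ^ 2) := by
        rw [lintegral_mul_const' _ _ ENNReal.ofReal_ne_top, ← ofReal_norm_sq,
          ← ENNReal.ofReal_mul (by positivity), ← ENNReal.ofReal_mul hC.le]
        congr 1
        field_simp

/-- Used with m = M‖f‖ to bound the inclusion into L²(e^{-α|·|²}dμ), and with m a small multiple of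
‖f‖ to approximate it by finite rank operators. -/
theorem AverageVanishes.exists_lintegral_le (H : w.Regular r p K) (hα : 0 < α) {s : ℝ}
    (hs : 0 < s) (hsr : s ≤ r / 2) {μ : Measure ℂ} (h : AverageVanishes w μ s) {ε : ℝ}
    (hε : 0 < ε) :
    ∃ R A : ℝ, 0 ≤ A ∧ ∀ (f : FockSpace α w) (m : ℝ), 0 ≤ m → (∀ ξ, ‖ξ‖ ≤ R → ‖f ξ‖ ≤ m) →
      ∫⁻ ξ, ‖f ξ‖ₑ ^ 2 ∂gaussDensity α μ ≤ ENNReal.ofReal (ε * ‖f‖ ^ 2 + A * m ^ 2) := by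
  have := h.isLocallyFiniteMeasure hs
  obtain ⟨R, hR⟩ := h.exists_setLIntegral_le (α := α) H hα hs hsr hε
  have hfin : gaussDensity α μ (Metric.ball 0 R) ≠ ⊤ :=
    ((gaussDensity_ball_le hα μ R).trans_lt measure_ball_lt_top).ne
  refine ⟨R, (gaussDensity α μ (Metric.ball 0 R)).toReal, ENNReal.toReal_nonneg,
    fun f m hm hf => ?_⟩
  have hSm : MeasurableSet {ξ : ℂ | R ≤ ‖ξ‖} :=
    (isClosed_le continuous_const continuous_norm).measurableSet
  have hcompl : {ξ : ℂ | R ≤ ‖ξ‖}ᶜ = Metric.ball 0 R := by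
    ext ξ
    simp
  rw [← lintegral_add_compl _ hSm, hcompl, ENNReal.ofReal_add (by positivity) (by positivity)]
  refine add_le_add (hR f) ?_
  rw [mul_comm, ENNReal.ofReal_mul (by positivity), ENNReal.ofReal_toReal hfin,
    ← setLIntegral_const]
  refine setLIntegral_mono' Metric.isOpen_ball.measurableSet fun ξ hξ => ?_
  rw [enorm_sq_eq_ofReal]
  have := hf ξ (le_of_lt (mem_ball_zero_iff.1 hξ))
  gcongr

theorem eLpNorm_two_sq {ν : Measure ℂ} (f : ℂ → ℂ) :
    eLpNorm f 2 ν ^ 2 = ∫⁻ ξ, ‖f ξ‖ₑ ^ 2 ∂ν := by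
  have h2 := eLpNorm_nnreal_pow_eq_lintegral (μ := ν) (f := f) (p := 2) two_ne_zero
  simpa using h2

theorem AverageVanishes.memLp (H : w.Regular r p K) (hα : 0 < α) {s : ℝ}
    (hs : 0 < s) (hsr : s ≤ r / 2) {μ : Measure ℂ} (h : AverageVanishes w μ s)
    (f : FockSpace α w) : MemLp f.1 2 (gaussDensity α μ) := by
  refine ⟨f.continuous.aestronglyMeasurable, ?_⟩
  obtain ⟨R, A, hA, hle⟩ := h.exists_lintegral_le (α := α) H hα hs hsr one_pos
  obtain ⟨M, hM, hb⟩ := exists_norm_apply_le (α := α) H hα R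
  refine (ENNReal.pow_lt_top_iff (n := 2)).1 ?_ |>.resolve_right two_ne_zero
  rw [eLpNorm_two_sq]
  exact (hle f (M * ‖f‖) (by positivity) fun ξ hξ => hb ξ hξ f).trans_lt ENNReal.ofReal_lt_top

/-- The inclusion of `F²_{α,w}` into `L²(e^{-α|ξ|²} dμ)`. -/
def inclusionLinear {ν : Measure ℂ} (h : ∀ f : FockSpace α w, MemLp f.1 2 ν) :
    FockSpace α w →ₗ[ℂ] Lp ℂ 2 ν where
  toFun f := (h f).toLp f.1
  map_add' _ _ := rfl
  map_smul' _ _ := rfl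

theorem norm_inclusionLinear_sq_le {ν : Measure ℂ} (h : ∀ f : FockSpace α w, MemLp f.1 2 ν)
    {f : FockSpace α w} {a : ℝ} (ha : 0 ≤ a)
    (hle : ∫⁻ ξ, ‖f ξ‖ₑ ^ 2 ∂ν ≤ ENNReal.ofReal a) : ‖inclusionLinear h f‖ ^ 2 ≤ a := by
  rw [← ENNReal.ofReal_le_ofReal_iff ha, ENNReal.ofReal_pow (norm_nonneg _), ofReal_norm]
  refine le_trans (le_of_eq ?_) hle
  rw [← eLpNorm_two_sq, ← Lp.enorm_toLp (h f)]
  rfl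

/-- Elements of `F²_{α,w}` are locally Lipschitz, uniformly on bounded sets. -/
theorem exists_norm_sub_le (H : w.Regular r p K) (hα : 0 < α) (R : ℝ) :
    ∃ L : ℝ, 0 < L ∧ ∀ c : ℂ, ‖c‖ ≤ R → ∀ ξ : ℂ, ‖ξ - c‖ < 1 → ∀ f : FockSpace α w,
      ‖f ξ - f c‖ ≤ L * ‖f‖ * ‖ξ - c‖ := by
  obtain ⟨M, hM, hb⟩ := exists_norm_apply_le (α := α) H hα (R + 1)
  refine ⟨2 * M, by positivity, fun c hc ξ hξ f => ?_⟩
  have hmaps : Set.MapsTo f.1 (Metric.ball c 1) (Metric.closedBall (f c) (2 * M * ‖f‖)) := by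
    intro η hη
    rw [Metric.mem_ball, Complex.dist_eq] at hη
    have h1 : ‖η‖ ≤ R + 1 := by
      have := norm_add_le c (η - c)
      rw [add_sub_cancel] at this
      linarith
    rw [Metric.mem_closedBall, dist_eq_norm]
    have := norm_sub_le (f η) (f c)
    linarith [hb η h1 f, hb c (by linarith) f]
  have := Complex.dist_le_div_mul_dist_of_mapsTo_ball f.differentiable.differentiableOn hmaps
    (by rwa [Metric.mem_ball, Complex.dist_eq] : ξ ∈ Metric.ball c 1)
  rwa [div_one, dist_eq_norm, Complex.dist_eq] at this

/-! ### Vanishing averages give compactness -/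

theorem isCompactOperator_of_forall_norm_sub_le {E F : Type*} [NormedAddCommGroup E]
    [NormedSpace ℂ E] [NormedAddCommGroup F] [NormedSpace ℂ F] [CompleteSpace F] {T : E →L[ℂ] F}
    (h : ∀ ε : ℝ, 0 < ε → ∃ S : E →L[ℂ] F, IsCompactOperator S ∧ ∀ x, ‖T x - S x‖ ≤ ε * ‖x‖) :
    IsCompactOperator T := by
  have hcl : IsClosed {T : E →L[ℂ] F | IsCompactOperator T} :=
    isClosed_setOfPred_isCompactOperator
  refine hcl.closure_subset (Metric.mem_closure_iff.2 fun ε hε => ?_)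
  obtain ⟨S, hS, hle⟩ := h (ε / 2) (half_pos hε)
  refine ⟨S, hS, ?_⟩
  rw [dist_eq_norm]
  exact (ContinuousLinearMap.opNorm_le_bound _ (half_pos hε).le hle).trans_lt (half_lt_self hε)

theorem toeplitzCompact_of_averageVanishes (H : w.Regular r p K) (hα : 0 < α) {s : ℝ}
    (hs : 0 < s) (hsr : s ≤ r / 2) {μ : Measure ℂ} (h : AverageVanishes w μ s) :
    ToeplitzCompact α w μ := by
  have := completeSpace (α := α) H hα
  set ν := gaussDensity α μ with hν
  have hmem : ∀ f : FockSpace α w, MemLp f.1 2 ν := h.memLp H hα hs hsr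
  obtain ⟨J, hJ⟩ : ∃ J : FockSpace α w →L[ℂ] Lp ℂ 2 ν, ∀ f, J f = inclusionLinear hmem f := by
    obtain ⟨R, A, hA, hle⟩ := h.exists_lintegral_le (α := α) H hα hs hsr one_pos
    obtain ⟨M, hM, hb⟩ := exists_norm_apply_le (α := α) H hα R
    refine ⟨(inclusionLinear hmem).mkContinuousOfExistsBound
      ⟨√(1 + A * M ^ 2), fun f => ?_⟩, fun f => rfl⟩
    refine le_of_sq_le_sq ?_ (by positivity)
    refine (norm_inclusionLinear_sq_le hmem (by positivity)
      (hle f (M * ‖f‖) (by positivity) fun ξ hξ => hb ξ hξ f)).trans (le_of_eq ?_)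
    rw [mul_pow (√_), Real.sq_sqrt (by positivity)]
    ring
  have hJc : IsCompactOperator J := by
    refine isCompactOperator_of_forall_norm_sub_le fun ε hε => ?_
    obtain ⟨R, A, hA, hle⟩ := h.exists_lintegral_le (α := α) H hα hs hsr
      (ε := ε ^ 2 / 8) (by positivity)
    obtain ⟨L, hL, hlip⟩ := exists_norm_sub_le (α := α) H hα R
    obtain ⟨η, hη0, hη1, hηε⟩ : ∃ η : ℝ, 0 < η ∧ η < 1 ∧ A * (L * η) ^ 2 ≤ ε ^ 2 / 8 := by
      refine ⟨min (1 / 2) (ε / (4 * L * (A + 1))), by positivity,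
        (min_le_left _ _).trans_lt (by norm_num), ?_⟩
      have h1 : min (1 / 2) (ε / (4 * L * (A + 1))) ≤ ε / (4 * L * (A + 1)) := min_le_right _ _
      calc A * (L * min (1 / 2) (ε / (4 * L * (A + 1)))) ^ 2
          ≤ A * (L * (ε / (4 * L * (A + 1)))) ^ 2 := by gcongr
        _ = A / (A + 1) ^ 2 * (ε ^ 2 / 16) := by field_simp; norm_num
        _ ≤ 1 * (ε ^ 2 / 8) := by
            gcongr
            · rw [div_le_one (by positivity)]; nlinarith
            · norm_num
        _ = _ := one_mul _
    obtain ⟨t, htR, ht, hcov⟩ := (isCompact_closedBall (0 : ℂ) R).finite_cover_balls hη0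
    -- Being orthogonal to U means vanishing on the η-net t. By the Lipschitz bound the component g
    -- of f in Uᗮ is then small on |ξ| ≤ R, so J composed with the projection onto U is a finite
    -- rank approximation of J.
    set U : Submodule ℂ (FockSpace α w) := Submodule.span ℂ (kernel α w '' t) with hU
    have hUfin : FiniteDimensional ℂ U := FiniteDimensional.span_of_finite ℂ (ht.image _)
    refine ⟨(J ∘L U.subtypeL) ∘L U.orthogonalProjectionOnto,
      (isCompactOperator_of_locallyCompactSpace_rng (J ∘L U.subtypeL)).comp_clm
        U.orthogonalProjectionOnto, fun f => ?_⟩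
    set g : FockSpace α w := f - U.starProjection f with hg
    have e1 : J f - ((J ∘L U.subtypeL) ∘L U.orthogonalProjectionOnto) f = J g := by
      rw [hg, map_sub]
      rfl
    have hgU : g ∈ Uᗮ := U.sub_starProjection_mem_orthogonal f
    have hgn : ‖g‖ ≤ ‖f‖ := by
      rcases (norm_nonneg g).eq_or_lt with h0 | h0
      · rw [← h0]; exact norm_nonneg f
      have e2 : inner ℂ f g = inner ℂ g g := by
        have h3 : inner ℂ (U.starProjection f) g = 0 := hgU _ (U.starProjection_apply_mem f)
        conv_rhs => rw [hg, inner_sub_left, ← hg, h3, sub_zero]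
      have h4 := norm_inner_le_norm (𝕜 := ℂ) f g
      rw [e2, inner_self_eq_norm_sq_to_K, norm_pow, RCLike.norm_ofReal, abs_norm, sq] at h4
      exact le_of_mul_le_mul_right h4 h0
    have hgc : ∀ c ∈ t, g c = 0 := fun c hc => by
      rw [← inner_kernel H hα]
      exact hgU _ (Submodule.subset_span ⟨c, hc, rfl⟩)
    have hgR : ∀ ξ, ‖ξ‖ ≤ R → ‖g ξ‖ ≤ L * ‖g‖ * η := by
      intro ξ hξ
      obtain ⟨c, hc, hξc⟩ := Set.mem_iUnion₂.1 (hcov (mem_closedBall_zero_iff.2 hξ))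
      rw [Metric.mem_ball, Complex.dist_eq] at hξc
      have h3 := hlip c (mem_closedBall_zero_iff.1 (htR hc)) ξ (hξc.trans hη1) g
      rw [hgc c hc, sub_zero] at h3
      exact h3.trans (by gcongr)
    have h5 : ‖J g‖ ^ 2 ≤ (ε * ‖f‖) ^ 2 := by
      rw [hJ]
      refine (norm_inclusionLinear_sq_le hmem (by positivity)
        (hle g _ (by positivity) hgR)).trans ?_
      calc ε ^ 2 / 8 * ‖g‖ ^ 2 + A * (L * ‖g‖ * η) ^ 2
          = ε ^ 2 / 8 * ‖g‖ ^ 2 + A * (L * η) ^ 2 * ‖g‖ ^ 2 := by ring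
        _ ≤ ε ^ 2 / 8 * ‖f‖ ^ 2 + ε ^ 2 / 8 * ‖f‖ ^ 2 := by gcongr
        _ ≤ _ := by nlinarith [sq_nonneg (ε * ‖f‖)]
    rw [e1]
    exact le_of_sq_le_sq h5 (by positivity)
  -- (J*J f)(z) = ⟨J*J f, B_z⟩ = ⟨J f, J B_z⟩, which is the integral defining T_μ f(z).
  refine ⟨J.adjoint ∘L J, fun f z => ?_, hJc.clm_comp J.adjoint⟩
  have hdens : ∀ ξ, (ENNReal.ofReal (Real.exp (-α * ‖ξ‖ ^ 2))).toReal •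
      (f ξ * conj (kernel α w z ξ)) = toeplitzIntegrand f z ξ := by
    intro ξ
    rw [ENNReal.toReal_ofReal (Real.exp_pos _).le, toeplitzIntegrand, Complex.real_smul, mul_comm]
  have hlt : ∀ᵐ ξ ∂μ, ENNReal.ofReal (Real.exp (-α * ‖ξ‖ ^ 2)) < ⊤ :=
    Eventually.of_forall fun _ => ENNReal.ofReal_lt_top
  constructor
  · have hint : Integrable (fun ξ => f ξ * conj (kernel α w z ξ)) ν :=
      (hmem f).integrable_mul (q := 2) (hmem (kernel α w z)).star
    rw [hν, gaussDensity, integrable_withDensity_iff_integrable_smul' (measurable_ofReal_exp α)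
      hlt] at hint
    exact hint.congr (Eventually.of_forall hdens)
  · rw [← inner_kernel H hα z, ContinuousLinearMap.comp_apply,
      ContinuousLinearMap.adjoint_inner_right, hJ, hJ, L2.inner_def]
    have e3 : ∫ ξ, inner ℂ (inclusionLinear hmem (kernel α w z) ξ) (inclusionLinear hmem f ξ) ∂ν =
        ∫ ξ, f ξ * conj (kernel α w z ξ) ∂ν := by
      refine integral_congr_ae ?_
      filter_upwards [(hmem f).coeFn_toLp, (hmem (kernel α w z)).coeFn_toLp] with ξ h1 h2
      change inner ℂ ((hmem (kernel α w z)).toLp _ ξ) ((hmem f).toLp _ ξ) = _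
      rw [h1, h2]
      rfl
    rw [e3, hν, gaussDensity,
      integral_withDensity_eq_integral_toReal_smul (measurable_ofReal_exp α) hlt]
    exact integral_congr_ae (Eventually.of_forall hdens)


end

end WFock

end

theorem corollary1p3 (α : ℝ) (hα : 0 < α) (w : WFock.Weight) (hw : w.MemAResInfty) :
    (∀ z : ℂ, WFock.IsReproducingKernelAt z (WFock.kernel α w z)) ∧
    ∃ δ : ℝ, 0 < δ ∧ δ < 1 ∧ ∀ μ : MeasureTheory.Measure ℂ,
      List.TFAE [
        WFock.ToeplitzCompact α w μ,
        Filter.Tendsto (WFock.berezin α w μ) (Bornology.cobounded ℂ) (nhds 0),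
        ∃ r : ℝ, 0 < r ∧ r < δ ∧ WFock.AverageVanishes w μ r,
        ∀ r : ℝ, 0 < r → r < δ → WFock.AverageVanishes w μ r] := by
  obtain ⟨r, p, K, H⟩ := hw.exists_regular
  -- δ is the radius on which |b_z| is bounded below; it is fixed before μ. The implication from
  -- averages to compactness uses only δ ≤ r/2.
  obtain ⟨δ, c, hδ, hδ1, hδr, hc, hlow⟩ := WFock.exists_le_normalizedKernel H hα
  refine ⟨WFock.FockSpace.isReproducingKernelAt_kernel H hα, δ, hδ, hδ1, fun μ => ?_⟩
  tfae_have 1 → 2 := WFock.tendsto_berezin_of_toeplitzCompact H hα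
  tfae_have 2 → 4 := fun h s hs hsδ =>
    WFock.averageVanishes_of_tendsto_berezin H hα hδr hc hlow h hs hsδ
  tfae_have 4 → 3 := fun h => ⟨δ / 2, half_pos hδ, half_lt_self hδ,
    h _ (half_pos hδ) (half_lt_self hδ)⟩
  tfae_have 3 → 1 := fun ⟨s, hs, hsδ, h⟩ =>
    WFock.toeplitzCompact_of_averageVanishes H hα hs (hsδ.le.trans hδr) h
  tfae_finish
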